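/- Let $I$ be an analytic P-ideal on $\mathbb N$ with $\mathrm{Fin}\subsetneq I$, where $\mathrm{Fin}$ is the ideal of finite sets. (Analytic: $I$ is an analytic subset of $2^{\mathbb N}$. P-ideal: for all $A_0,A_1,\ldots\in I$ there is $B\in I$ with $A_k\setminus B$ finite for every $k$.) A lower semi-continuous submeasure on $\mathbb N$ is a function $\varphi:\mathcal P(\mathbb N)\to[0,\infty]$ with $\varphi(\emptyset)=0$; $\varphi(A)\le\varphi(B)$ whenever $A\subseteq B$; $\varphi(A\cup B)\le\varphi(A)+\varphi(B)$; $\varphi(\{n\})<\infty$ for all $n$; and $\varphi(\bigcup_m A_m)=\lim_m\varphi(A_m)$ whenever $A_0\subseteq A_1\subseteq\cdots$. Put $\mathrm{Exh}(\varphi)=\{A\subseteq\mathbb N:\lim_m\varphi(A\setminus[0,m])=0\}$. Let $S_I$ be the group of all permutations $g$ of $\mathbb N$ whose support $\{x:g(x)\ne x\}$ belongs to $I$. Then there is a lower semi-continuous submeasure $\varphi$ with $\varphi(\{n\})>0$ for all $n\in\mathbb N$ and $I=\mathrm{Exh}(\varphi)$. Moreover, for every such $\varphi$, the group $S_I$ with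 the topology of the metric $d(f,g)=\varphi(\{x: f(x)\neq g(x)\})$ is a Polish topological group with ample generics: for every $n\in\mathbb N$, the diagonal action of $S_I$ on $S_I^{n+1}$ by conjugation, $g\cdot(g_0,\ldots,g_n)=(gg_0g^{-1},\ldots,gg_ng^{-1})$, has a comeager orbit. -/

import Mathlib

open Set Filter Topology
open scoped ENNReal

/-- A lower semi-continuous submeasure on `ℕ`. -/
structure LSCSubmeasure where
  /-- The underlying set function `𝒫(ℕ) → [0, ∞]`. -/
  toFun : Set ℕ → ℝ≥0∞
  map_empty : toFun ∅ = 0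
  mono : ∀ A B : Set ℕ, A ⊆ B → toFun A ≤ toFun B
  union_le : ∀ A B : Set ℕ, toFun (A ∪ B) ≤ toFun A + toFun B
  singleton_lt_top : ∀ n : ℕ, toFun {n} < ∞
  lsc : ∀ A : ℕ → Set ℕ, (∀ m, A m ⊆ A (m + 1)) →
    Tendsto (fun m => toFun (A m)) atTop (𝓝 (toFun (⋃ m, A m)))

instance : CoeFun LSCSubmeasure (fun _ => Set ℕ → ℝ≥0∞) := ⟨LSCSubmeasure.toFun⟩

/-- The exhaustive ideal `Exh(φ) = {A ⊆ ℕ : lim_m φ(A \ [0, m]) = 0}`. -/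
def LSCSubmeasure.Exh (φ : LSCSubmeasure) : Set (Set ℕ) :=
  {A | Tendsto (fun m : ℕ => φ (A \ Set.Icc 0 m)) atTop (𝓝 0)}

/-- An ideal on `ℕ` is analytic if, identifying subsets of `ℕ` with their characteristic
functions, it is an analytic subset of the Cantor space `2^ℕ`. -/
def IsAnalyticIdeal (I : Order.Ideal (Set ℕ)) : Prop :=
  MeasureTheory.AnalyticSet {x : ℕ → Bool | {n : ℕ | x n = true} ∈ I}

/-- An ideal is a P-ideal if every sequence of its members is almost contained (i.e. up to finite
sets) in a single member. -/
def IsPIdeal (I : Order.Ideal (Set ℕ)) : Prop :=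
  ∀ A : ℕ → Set ℕ, (∀ k, A k ∈ I) → ∃ B ∈ I, ∀ k, (A k \ B).Finite

/-- The group `S_I` of all permutations of `ℕ` whose support belongs to the ideal `I`. -/
def idealPerm (I : Order.Ideal (Set ℕ)) : Subgroup (Equiv.Perm ℕ) where
  carrier := {g | {x : ℕ | g x ≠ x} ∈ I}
  one_mem' := by
    have h : {x : ℕ | (1 : Equiv.Perm ℕ) x ≠ x} = ⊥ := by ext x; simp
    rw [Set.mem_ofPred_eq, h]
    exact I.bot_mem
  mul_mem' := by
    intro f g hf hg
    refine I.lower ?_ (I.sup_mem hf hg)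
    intro x hx
    by_contra hcon
    have h : ¬ (f x ≠ x ∨ g x ≠ x) := hcon
    push Not at h
    exact hx (by rw [Equiv.Perm.mul_apply, h.2, h.1])
  inv_mem' := by
    intro f hf
    refine I.lower ?_ hf
    intro x hx hfx
    exact hx (by rw [Equiv.Perm.inv_eq_iff_eq]; exact hfx.symm)

/-- The distance `d(f, g) = φ({f ≠ g})` on `S_I`. -/
@[reducible]
noncomputable def idealPermDist (I : Order.Ideal (Set ℕ)) (φ : LSCSubmeasure) :
    PseudoEMetricSpace (idealPerm I) where
  edist f g := φ {x : ℕ | f.1 x ≠ g.1 x}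
  edist_self f := by simpa using φ.map_empty
  edist_comm f g := by simp only [ne_comm]
  edist_triangle f g h := by
    refine (φ.mono _ _ ?_).trans (φ.union_le _ _)
    intro x hx
    by_contra hcon
    have h' : ¬ (f.1 x ≠ g.1 x ∨ g.1 x ≠ h.1 x) := hcon
    push Not at h'
    exact hx (h'.1.trans h'.2)

/-- The topology on `S_I` given by the distance `d(f, g) = φ({f ≠ g})`. -/
@[reducible]
noncomputable def idealPermTopology (I : Order.Ideal (Set ℕ)) (φ : LSCSubmeasure) :
    TopologicalSpace (idealPerm I) :=
  (idealPermDist I φ).toUniformSpace.toTopologicalSpace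

/-- A group with a topology has ample generics if it is a Polish topological group and, for every
`n`, the diagonal action of `G` on `G^(n+1)` by conjugation has a comeager orbit. -/
def HasAmpleGenerics (G : Type*) [Group G] [TopologicalSpace G] : Prop :=
  IsTopologicalGroup G ∧ PolishSpace G ∧
    ∀ n : ℕ, ∃ x : Fin (n + 1) → G,
      {y : Fin (n + 1) → G | ∃ g : G, ∀ i, y i = g * x i * g⁻¹} ∈ residual (Fin (n + 1) → G)

/-! The existence of `φ` is Solecki's theorem. Being analytic, `I` is the range of a map `F` on
Baire space for which a finite inclusion `a ⊆ F x` depends only on an initial segment of `x`. By the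
P-property, the sets of codes on which `F` is not cofinal modulo finite sets form a σ-ideal, so
there is a kernel `Z` all of whose nonempty relatively open pieces are cofinal. The finite sets
covered from such pieces behave like neighbourhoods of zero: fusion shows that they detect
membership in `I` (`mem_of_forall_tailIn`) and that they can be halved
(`IsLargeFamily.exists_union_mem`). A Birkhoff–Kakutani chain argument (`mem_of_listWeight_lt`) then
turns a sequence of them into a submeasure.

For ample generics, fix an infinite `E ∈ I`. A generic tuple has finite joint orbits and contains a
copy of every tuple of permutations of a finite set, inside `E` and beyond any bound; each
requirement is open, and dense because `E` has `φ`-small tails. Restricted to `E` together with the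
supports, two such tuples are actions of a free group in which the same finite orbit types occur,
each infinitely often. They are therefore isomorphic (`exists_equiv_smul`), and the isomorphism,
extended by the identity, is a conjugator in `S_I`. -/

/-! ### Cofinal sets of codes and their kernel. -/

/-- The values of `F` on `S` are cofinal in `I` with respect to almost inclusion. -/
def CofinalOn (I : Order.Ideal (Set ℕ)) (F : (ℕ → ℕ) → Set ℕ) (S : Set (ℕ → ℕ)) : Prop :=
  ∀ A ∈ I, ∃ x ∈ S, (A \ F x).Finite

theorem CofinalOn.mono {I : Order.Ideal (Set ℕ)} {F : (ℕ → ℕ) → Set ℕ} {S T : Set (ℕ → ℕ)}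
    (h : CofinalOn I F S) (hST : S ⊆ T) : CofinalOn I F T := fun A hA => by
  obtain ⟨x, hx, hf⟩ := h A hA
  exact ⟨x, hST hx, hf⟩

/-- In a P-ideal, the sets on which `F` is not cofinal are closed under countable unions. -/
theorem IsPIdeal.not_cofinalOn_sUnion {I : Order.Ideal (Set ℕ)} (hP : IsPIdeal I)
    {F : (ℕ → ℕ) → Set ℕ} {T : Set (Set (ℕ → ℕ))} (hT : T.Countable)
    (h : ∀ S ∈ T, ¬ CofinalOn I F S) : ¬ CofinalOn I F (⋃₀ T) := by
  intro hc
  rcases T.eq_empty_or_nonempty with rfl | hne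
  · obtain ⟨x, hx, -⟩ := hc ⊥ I.bot_mem
    simp at hx
  obtain ⟨S, rfl⟩ := hT.exists_eq_range hne
  have h1 : ∀ k, ∃ A ∈ I, ∀ x ∈ S k, ¬ (A \ F x).Finite := by
    intro k
    have := h (S k) ⟨k, rfl⟩
    unfold CofinalOn at this
    push Not at this
    exact this
  choose A hA hAx using h1
  -- If `F x` with `x ∈ S k` almost contains `B`, it almost contains `A k`, against the choice of `A
  -- k`.
  obtain ⟨B, hB, hAB⟩ := hP A hA
  obtain ⟨x, ⟨_, ⟨k, rfl⟩, hx⟩, hfin⟩ := hc B hB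
  refine hAx k x hx (((hAB k).union hfin).subset ?_)
  intro p hp
  by_cases hpB : p ∈ B
  · exact Or.inr ⟨hpB, hp.2⟩
  · exact Or.inl ⟨hp.1, hpB⟩

/-- The points all of whose neighbourhoods are cofinal form a nonempty set which is itself
cofinal near each of its points. -/
theorem IsPIdeal.exists_cofinal_kernel {I : Order.Ideal (Set ℕ)} (hP : IsPIdeal I)
    {F : (ℕ → ℕ) → Set ℕ} (hF : CofinalOn I F univ) :
    ∃ Z : Set (ℕ → ℕ), Z.Nonempty ∧
      ∀ x ∈ Z, ∀ n, CofinalOn I F (PiNat.cylinder x n ∩ Z) := by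
  set N : Set (Set (ℕ → ℕ)) := {S | IsOpen S ∧ ¬ CofinalOn I F S} with hN
  -- Lindelöf: countably many members of `N` already cover `⋃₀ N`, so removing this union preserves
  -- cofinality.
  obtain ⟨T, hTc, hTN, hTU⟩ := TopologicalSpace.isOpen_sUnion_countable N (fun s hs => hs.1)
  have hsmall : ∀ S, CofinalOn I F S → CofinalOn I F (S ∩ (⋃₀ N)ᶜ) := by
    intro S hS
    by_contra hcon
    have h1 : ¬ CofinalOn I F (⋃₀ (insert (S ∩ (⋃₀ N)ᶜ) T)) := by
      refine hP.not_cofinalOn_sUnion (hTc.insert _) ?_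
      rintro s (rfl | hs)
      · exact hcon
      · exact (hTN hs).2
    refine h1 (hS.mono ?_)
    rw [sUnion_insert, hTU]
    intro x hx
    by_cases hxN : x ∈ ⋃₀ N
    · exact Or.inr hxN
    · exact Or.inl ⟨hx, hxN⟩
  refine ⟨(⋃₀ N)ᶜ, ?_, ?_⟩
  · obtain ⟨x, hx, -⟩ := hsmall _ hF ⊥ I.bot_mem
    exact ⟨x, hx.2⟩
  · intro x hx n
    refine hsmall _ ?_
    by_contra hcon
    exact hx ⟨_, ⟨PiNat.isOpen_cylinder _ x n, hcon⟩, PiNat.self_mem_cylinder x n⟩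

/-- Completeness of Baire space: as `n` is strictly increasing, coordinate `j` no longer changes
from stage `j + 1` on. -/
theorem exists_mem_cylinders {x : ℕ → ℕ → ℕ} {n : ℕ → ℕ} (hn : ∀ i, n i < n (i + 1))
    (hx : ∀ i, x (i + 1) ∈ PiNat.cylinder (x i) (n i)) :
    ∃ y, ∀ i, y ∈ PiNat.cylinder (x i) (n i) := by
  have hmono : StrictMono n := strictMono_nat_of_lt_succ hn
  have key : ∀ i k j, j < n i → x (i + k) j = x i j := by
    intro i k j hj
    induction k with
    | zero => rfl
    | succ k ih =>
      rw [← ih]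
      exact hx (i + k) j (hj.trans_le (hmono.monotone (Nat.le_add_right _ _)))
  refine ⟨fun j => x (j + 1) j, fun i j hj => ?_⟩
  have hj1 : j < n (j + 1) := Nat.lt_of_lt_of_le (Nat.lt_succ_self j) hmono.le_apply
  change x (j + 1) j = x i j
  rcases le_total i (j + 1) with h | h
  · obtain ⟨k, hk⟩ := Nat.exists_eq_add_of_le h
    rw [hk, key i k j hj]
  · obtain ⟨k, hk⟩ := Nat.exists_eq_add_of_le h
    rw [hk, key (j + 1) k j hj1]

/-! ### Large families of finite sets. -/

/-- All finite subsets of some tail of `A` belong to the family `𝓚`. -/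
def TailIn (𝓚 : Set (Finset ℕ)) (A : Set ℕ) : Prop :=
  ∃ m : ℕ, ∀ a : Finset ℕ, ↑a ⊆ A → (∀ p ∈ a, m ≤ p) → a ∈ 𝓚

theorem TailIn.mono {𝓚 𝓛 : Set (Finset ℕ)} {A : Set ℕ} (h : TailIn 𝓚 A) (hKL : 𝓚 ⊆ 𝓛) :
    TailIn 𝓛 A :=
  let ⟨m, hm⟩ := h
  ⟨m, fun a ha hp => hKL (hm a ha hp)⟩

theorem TailIn.inter {𝓚 𝓛 : Set (Finset ℕ)} {A : Set ℕ} (h : TailIn 𝓚 A) (h' : TailIn 𝓛 A) :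
    TailIn (𝓚 ∩ 𝓛) A := by
  obtain ⟨m, hm⟩ := h
  obtain ⟨n, hn⟩ := h'
  exact ⟨max m n, fun a ha hp => ⟨hm a ha fun p hpa => (le_max_left _ _).trans (hp p hpa),
    hn a ha fun p hpa => (le_max_right _ _).trans (hp p hpa)⟩⟩

theorem tailIn_tail (n : ℕ) (A : Set ℕ) : TailIn {a | ∀ p ∈ a, n ≤ p} A :=
  ⟨n, fun _ _ h => h⟩

/-- A family of finite sets closed under subsets, and containing the finite subsets of some tail
of each member of `I`. -/
structure IsLargeFamily (I : Order.Ideal (Set ℕ)) (𝓚 : Set (Finset ℕ)) : Prop where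
  lower : IsLowerSet 𝓚
  tailIn : ∀ A ∈ I, TailIn 𝓚 A

theorem IsLargeFamily.inter {I : Order.Ideal (Set ℕ)} {𝓚 𝓛 : Set (Finset ℕ)}
    (h : IsLargeFamily I 𝓚) (h' : IsLargeFamily I 𝓛) : IsLargeFamily I (𝓚 ∩ 𝓛) :=
  ⟨h.lower.inter h'.lower, fun A hA => (h.tailIn A hA).inter (h'.tailIn A hA)⟩

theorem isLargeFamily_tail (I : Order.Ideal (Set ℕ)) (n : ℕ) :
    IsLargeFamily I {a | ∀ p ∈ a, n ≤ p} :=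
  ⟨fun _ _ hba ha p hp => ha p (hba hp), fun A _ => tailIn_tail n A⟩

/-- The finite sets contained in `F x` for some `x ∈ S`. -/
def coveredBy (F : (ℕ → ℕ) → Set ℕ) (S : Set (ℕ → ℕ)) : Set (Finset ℕ) :=
  {a | ∃ x ∈ S, ↑a ⊆ F x}

theorem coveredBy_mono (F : (ℕ → ℕ) → Set ℕ) {S T : Set (ℕ → ℕ)} (h : S ⊆ T) :
    coveredBy F S ⊆ coveredBy F T := fun _ ⟨x, hx, hax⟩ => ⟨x, h hx, hax⟩

/-- Beyond the finite error `A \ F x`, every finite subset of `A` lies in `F x`. -/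
theorem CofinalOn.isLargeFamily {I : Order.Ideal (Set ℕ)} {F : (ℕ → ℕ) → Set ℕ}
    {S : Set (ℕ → ℕ)} (h : CofinalOn I F S) : IsLargeFamily I (coveredBy F S) := by
  refine ⟨fun a b hba ⟨x, hx, hax⟩ => ⟨x, hx, fun p hp => hax (hba hp)⟩, fun A hA => ?_⟩
  obtain ⟨x, hx, hfin⟩ := h A hA
  obtain ⟨m, hm⟩ := hfin.bddAbove
  refine ⟨m + 1, fun a haA hp => ⟨x, hx, fun p hpa => ?_⟩⟩
  by_contra hcon
  have := hm ⟨haA hpa, hcon⟩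
  have := hp p hpa
  omega

/-! ### Fusion along the kernel. -/

section Fusion

variable {I : Order.Ideal (Set ℕ)} {F : (ℕ → ℕ) → Set ℕ} {Z : Set (ℕ → ℕ)}

/-- If every tail of `B` is finitely covered near each point of the kernel then `B` is covered
by two members of the ideal. -/
theorem mem_of_forall_tailIn (hFin : ∀ A : Set ℕ, A.Finite → A ∈ I) (hFI : ∀ x, F x ∈ I)
    (hcont : ∀ x (a : Finset ℕ), ↑a ⊆ F x → ∃ n, ∀ y ∈ PiNat.cylinder x n, ↑a ⊆ F y)
    (hZ : Z.Nonempty) {B : Set ℕ}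
    (hB : ∀ x ∈ Z, ∀ n, TailIn (coveredBy F (PiNat.cylinder x n ∩ Z)) B) : B ∈ I := by
  classical
  choose! m hm using hB
  have step : ∀ x ∈ Z, ∀ n M, m x n ≤ M → ∀ M', ∃ x' ∈ Z, x' ∈ PiNat.cylinder x n ∧ ∃ n' > n,
      ∀ y ∈ PiNat.cylinder x' n', B ∩ Ico M M' ⊆ F y := by
    intro x hx n M hM M'
    have hfin : (B ∩ Ico M M').Finite := (finite_Ico M M').subset inter_subset_right
    obtain ⟨x', ⟨hx'c, hx'Z⟩, hcov⟩ := hm x hx n hfin.toFinset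
      (by simp) (fun p hp => hM.trans (by simp at hp; exact hp.2.1))
    obtain ⟨n', hn'⟩ := hcont x' _ hcov
    refine ⟨x', hx'Z, hx'c, max n' (n + 1), ?_, fun y hy => ?_⟩
    · exact lt_of_lt_of_le (Nat.lt_succ_self n) (le_max_right _ _)
    · simpa using hn' y (PiNat.cylinder_anti _ (le_max_left _ _) hy)
  -- A state: the two points, the lengths of their cylinders, and the bound reached.
  let St := {s : (ℕ → ℕ) × ℕ × (ℕ → ℕ) × ℕ × ℕ //
    s.1 ∈ Z ∧ s.2.2.1 ∈ Z ∧ m s.1 s.2.1 ≤ s.2.2.2.2}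
  have next : ∀ s : St, ∃ t : St, s.1.2.1 < t.1.2.1 ∧ t.1.1 ∈ PiNat.cylinder s.1.1 s.1.2.1 ∧
      s.1.2.2.2.1 < t.1.2.2.2.1 ∧ t.1.2.2.1 ∈ PiNat.cylinder s.1.2.2.1 s.1.2.2.2.1 ∧
      s.1.2.2.2.2 < t.1.2.2.2.2 ∧
      ∀ u ∈ PiNat.cylinder t.1.1 t.1.2.1, ∀ v ∈ PiNat.cylinder t.1.2.2.1 t.1.2.2.2.1,
        B ∩ Ico s.1.2.2.2.2 t.1.2.2.2.2 ⊆ F u ∪ F v := by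
    rintro ⟨⟨x, n, y, k, M⟩, hx, hy, hM⟩
    -- A single branch would leave gaps, since the tail bound at `x'` is known only once `x'` is
    -- chosen. So `x'` covers up to the bound valid at `y`, and then `y'` covers up to the bound
    -- valid at `x'`; the terms `M + 1` ensure progress.
    obtain ⟨x', hx'Z, hx', n', hn', hcx⟩ := step x hx n M hM (max (m y k) (M + 1))
    obtain ⟨y', hy'Z, hy', k', hk', hcy⟩ := step y hy k (max (m y k) (M + 1)) (le_max_left _ _)
      (max (m x' n') (M + 1))
    refine ⟨⟨⟨x', n', y', k', max (m x' n') (M + 1)⟩, hx'Z, hy'Z, le_max_left _ _⟩, hn', hx', hk',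
      hy', lt_of_lt_of_le (Nat.lt_succ_self M) (le_max_right _ _), ?_⟩
    rintro u hu v hv p ⟨hpB, hp1, hp2⟩
    by_cases hp : p < max (m y k) (M + 1)
    · exact Or.inl (hcx u hu ⟨hpB, hp1, hp⟩)
    · exact Or.inr (hcy v hv ⟨hpB, not_lt.1 hp, hp2⟩)
  choose nxt h1 h2 h3 h4 h5 h6 using next
  obtain ⟨z, hz⟩ := hZ
  let s : ℕ → St := fun i => Nat.rec ⟨⟨z, 0, z, 0, m z 0⟩, hz, hz, le_rfl⟩ (fun _ t => nxt t) i
  obtain ⟨u, hu⟩ := exists_mem_cylinders (x := fun i => (s i).1.1) (n := fun i => (s i).1.2.1)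
    (fun i => h1 (s i)) (fun i => h2 (s i))
  obtain ⟨v, hv⟩ := exists_mem_cylinders (x := fun i => (s i).1.2.2.1)
    (n := fun i => (s i).1.2.2.2.1) (fun i => h3 (s i)) (fun i => h4 (s i))
  have hMmono : StrictMono fun i => (s i).1.2.2.2.2 := strictMono_nat_of_lt_succ fun i => h5 (s i)
  refine I.lower (?_ : B ≤ (F u ⊔ F v) ⊔ Iio (m z 0))
    (I.sup_mem (I.sup_mem (hFI u) (hFI v)) (hFin _ (finite_Iio _)))
  intro p hpB
  have key : ∀ i, p < (s i).1.2.2.2.2 → p ∈ (F u ⊔ F v) ⊔ Iio (m z 0) := by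
    intro i
    induction i with
    | zero => exact fun h => Or.inr h
    | succ i ih =>
      intro h
      by_cases hp : p < (s i).1.2.2.2.2
      · exact ih hp
      · exact Or.inl (h6 (s i) u (hu (i + 1)) v (hv (i + 1)) ⟨hpB, not_lt.1 hp, h⟩)
  exact key (p + 1) (lt_of_lt_of_le (Nat.lt_succ_self p) hMmono.le_apply)

/-- Every large family contains the pairwise unions of some smaller large family. -/
theorem IsLargeFamily.exists_union_mem (hFI : ∀ x, F x ∈ I)
    (hcont : ∀ x (a : Finset ℕ), ↑a ⊆ F x → ∃ n, ∀ y ∈ PiNat.cylinder x n, ↑a ⊆ F y)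
    (hZ : Z.Nonempty) (hZc : ∀ x ∈ Z, ∀ n, CofinalOn I F (PiNat.cylinder x n ∩ Z))
    {𝓚 : Set (Finset ℕ)} (hK : IsLargeFamily I 𝓚) :
    ∃ 𝓛, IsLargeFamily I 𝓛 ∧ ∀ a ∈ 𝓛, ∀ b ∈ 𝓛, a ∪ b ∈ 𝓚 := by
  classical
  suffices h : ∃ x ∈ Z, ∃ y ∈ Z, ∃ n m, ∀ a ∈ coveredBy F (PiNat.cylinder x n ∩ Z),
      ∀ b ∈ coveredBy F (PiNat.cylinder y n ∩ Z), (∀ p ∈ a, m ≤ p) → (∀ p ∈ b, m ≤ p) →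
        a ∪ b ∈ 𝓚 by
    obtain ⟨x, hx, y, hy, n, m, h⟩ := h
    exact ⟨_, ((hZc x hx n).isLargeFamily.inter (hZc y hy n).isLargeFamily).inter
      (isLargeFamily_tail I m), fun a ha b hb => h a ha.1.1 b hb.1.2 ha.2 hb.2⟩
  -- If no two pieces work, descend along both branches, placing at each stage a finite set outside
  -- `𝓚` into `F u ∪ F v`. Such sets occur arbitrarily far out, although `F u ∪ F v ∈ I` has a tail
  -- in `𝓚`.
  by_contra! hcon
  let St := {s : (ℕ → ℕ) × (ℕ → ℕ) × ℕ // s.1 ∈ Z ∧ s.2.1 ∈ Z}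
  have next : ∀ s : St, ∃ t : St, s.1.2.2 < t.1.2.2 ∧
      t.1.1 ∈ PiNat.cylinder s.1.1 s.1.2.2 ∧ t.1.2.1 ∈ PiNat.cylinder s.1.2.1 s.1.2.2 ∧
      ∀ u ∈ PiNat.cylinder t.1.1 t.1.2.2, ∀ v ∈ PiNat.cylinder t.1.2.1 t.1.2.2,
        ∃ a : Finset ℕ, a ∉ 𝓚 ∧ ↑a ⊆ F u ∪ F v ∧ ∀ p ∈ a, s.1.2.2 ≤ p := by
    rintro ⟨⟨x, y, n⟩, hx, hy⟩
    obtain ⟨a, ⟨x', ⟨hx', hx'Z⟩, hax⟩, b, ⟨y', ⟨hy', hy'Z⟩, hby⟩, ham, hbm, hab⟩ :=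
      hcon x hx y hy n n
    obtain ⟨n1, hn1⟩ := hcont x' a hax
    obtain ⟨n2, hn2⟩ := hcont y' b hby
    refine ⟨⟨⟨x', y', max (max n1 n2) (n + 1)⟩, hx'Z, hy'Z⟩,
      lt_of_lt_of_le (Nat.lt_succ_self n) (le_max_right _ _), hx', hy',
      fun u hu v hv => ⟨a ∪ b, hab, ?_, ?_⟩⟩
    · rw [Finset.coe_union]
      exact union_subset_union
        (hn1 u (PiNat.cylinder_anti _ ((le_max_left _ _).trans (le_max_left _ _)) hu))
        (hn2 v (PiNat.cylinder_anti _ ((le_max_right _ _).trans (le_max_left _ _)) hv))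
    · intro p hp
      rcases Finset.mem_union.1 hp with hp | hp
      · exact ham p hp
      · exact hbm p hp
  choose nxt h1 h2 h3 h4 using next
  obtain ⟨z, hz⟩ := hZ
  let s : ℕ → St := fun i => Nat.rec ⟨⟨z, z, 0⟩, hz, hz⟩ (fun _ t => nxt t) i
  have hmono : StrictMono fun i => (s i).1.2.2 := strictMono_nat_of_lt_succ fun i => h1 (s i)
  obtain ⟨u, hu⟩ := exists_mem_cylinders (x := fun i => (s i).1.1) (n := fun i => (s i).1.2.2)
    (fun i => h1 (s i)) (fun i => h2 (s i))
  obtain ⟨v, hv⟩ := exists_mem_cylinders (x := fun i => (s i).1.2.1) (n := fun i => (s i).1.2.2)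
    (fun i => h1 (s i)) (fun i => h3 (s i))
  obtain ⟨m, hm⟩ := hK.tailIn (F u ∪ F v) (I.sup_mem (hFI u) (hFI v))
  obtain ⟨a, haK, hauv, ham⟩ := h4 (s m) u (hu (m + 1)) v (hv (m + 1))
  exact haK (hm a hauv fun p hp => (hmono.le_apply (x := m)).trans (ham p hp))

end Fusion

/-- An analytic P-ideal is described by a sequence of hereditary families of finite sets which
behaves like a neighbourhood base at zero. -/
theorem IsPIdeal.exists_families {I : Order.Ideal (Set ℕ)} (hP : IsPIdeal I)
    (hA : IsAnalyticIdeal I) (hFin : ∀ A : Set ℕ, A.Finite → A ∈ I) :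
    ∃ U : ℕ → Set (Finset ℕ), (∀ n, IsLowerSet (U n)) ∧ U 0 = univ ∧
      (∀ n, ∀ a ∈ U (n + 1), ∀ b ∈ U (n + 1), ∀ c ∈ U (n + 1), a ∪ b ∪ c ∈ U n) ∧
      (∀ n, {n} ∉ U (n + 1)) ∧ ∀ A, A ∈ I ↔ ∀ n, TailIn (U n) A := by
  classical
  obtain ⟨F, hFI, hFs, hcont⟩ : ∃ F : (ℕ → ℕ) → Set ℕ, (∀ x, F x ∈ I) ∧
      (∀ A ∈ I, ∃ x, F x = A) ∧
      ∀ x (a : Finset ℕ), ↑a ⊆ F x → ∃ n, ∀ y ∈ PiNat.cylinder x n, ↑a ⊆ F y := by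
    rw [IsAnalyticIdeal, MeasureTheory.AnalyticSet] at hA
    rcases hA with hA | ⟨f, hf, hfr⟩
    · have : (fun _ => false) ∈ {x : ℕ → Bool | {n : ℕ | x n = true} ∈ I} := by
        simpa using I.bot_mem
      rw [hA] at this
      exact this.elim
    · refine ⟨fun x => {n | f x n = true}, fun x => ?_, fun A hA => ?_, fun x a hax => ?_⟩
      · have : f x ∈ range f := ⟨x, rfl⟩
        rw [hfr] at this
        exact this
      · have : (fun n => decide (n ∈ A)) ∈ range f := by
          rw [hfr]
          simpa using hA
        obtain ⟨x, hx⟩ := this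
        exact ⟨x, by simp [hx]⟩
      · have hopen : IsOpen {y | ∀ p ∈ a, f y p = true} := by
          have : {y | ∀ p ∈ a, f y p = true} = ⋂ p ∈ a, (fun y => f y p) ⁻¹' {true} := by
            ext; simp
          rw [this]
          refine isOpen_biInter_finset fun p _ => ?_
          exact (isOpen_discrete _).preimage ((continuous_apply p).comp hf)
        obtain ⟨_, ⟨z, n, rfl⟩, hxz, hsub⟩ :=
          (PiNat.isTopologicalBasis_cylinders (fun _ => ℕ)).exists_subset_of_mem_open
            (show x ∈ {y | ∀ p ∈ a, f y p = true} from fun p hp => hax hp) hopen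
        rw [← PiNat.mem_cylinder_iff_eq.1 hxz] at hsub
        exact ⟨n, fun y hy p hp => hsub hy p hp⟩
  obtain ⟨Z, hZ, hZc⟩ := hP.exists_cofinal_kernel (F := F) (fun A hA => by
    obtain ⟨x, rfl⟩ := hFs A hA
    exact ⟨x, mem_univ _, by simp⟩)
  obtain ⟨K, hKl, hKI⟩ : ∃ K : ℕ → Set (Finset ℕ), (∀ n, IsLargeFamily I (K n)) ∧
      ∀ B, (∀ n, TailIn (K n) B) → B ∈ I := by
    -- Countably many pieces suffice: every cylinder about a point of `Z` contains a basic open set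
    -- meeting `Z`.
    let C : Set (Set (ℕ → ℕ)) :=
      {O ∈ TopologicalSpace.countableBasis (ℕ → ℕ) | (O ∩ Z).Nonempty}
    have hC : C.Countable :=
      (TopologicalSpace.countable_countableBasis _).mono (sep_subset _ _)
    have hCne : C.Nonempty := by
      obtain ⟨z, hz⟩ := hZ
      obtain ⟨O, hO, hzO, -⟩ := (TopologicalSpace.isBasis_countableBasis
        (ℕ → ℕ)).exists_subset_of_mem_open (mem_univ z) isOpen_univ
      exact ⟨O, hO, z, hzO, hz⟩
    obtain ⟨O, hO⟩ := hC.exists_eq_range hCne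
    refine ⟨fun n => coveredBy F (O n ∩ Z), fun n => ?_, fun B hB => ?_⟩
    · obtain ⟨hOb, z, hzO, hzZ⟩ : O n ∈ C := hO ▸ mem_range_self n
      obtain ⟨_, ⟨x, k, rfl⟩, hzx, hsub⟩ :=
        (PiNat.isTopologicalBasis_cylinders (fun _ => ℕ)).exists_subset_of_mem_open hzO
          (TopologicalSpace.isOpen_of_mem_countableBasis hOb)
      rw [← PiNat.mem_cylinder_iff_eq.1 hzx] at hsub
      exact ((hZc z hzZ k).mono (inter_subset_inter_left _ hsub)).isLargeFamily
    · refine mem_of_forall_tailIn hFin hFI hcont hZ fun x hx n => ?_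
      obtain ⟨V, hV, hxV, hsub⟩ := (TopologicalSpace.isBasis_countableBasis
        (ℕ → ℕ)).exists_subset_of_mem_open (PiNat.self_mem_cylinder x n)
          (PiNat.isOpen_cylinder _ x n)
      have : V ∈ C := ⟨hV, x, hxV, hx⟩
      rw [hO] at this
      obtain ⟨k, rfl⟩ := this
      exact (hB k).mono (coveredBy_mono F (inter_subset_inter_left _ hsub))
  have next : ∀ (n : ℕ) (𝓚 : {𝓚 // IsLargeFamily I 𝓚}), ∃ 𝓛 : {𝓛 // IsLargeFamily I 𝓛},
      (∀ a ∈ 𝓛.1, ∀ b ∈ 𝓛.1, ∀ c ∈ 𝓛.1, a ∪ b ∪ c ∈ 𝓚.1) ∧ 𝓛.1 ⊆ K n ∧ {n} ∉ 𝓛.1 := by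
    rintro n ⟨𝓚, hK⟩
    obtain ⟨𝓛, hL, hLK⟩ := hK.exists_union_mem hFI hcont hZ hZc
    obtain ⟨𝓜, hM, hML⟩ := hL.exists_union_mem hFI hcont hZ hZc
    -- Halving twice controls triple unions. The factor `K n` lets the sequence detect `I`, and the
    -- tail beyond `n` excludes `{n}`, which later makes `φ {n}` positive.
    refine ⟨⟨𝓛 ∩ 𝓜 ∩ K n ∩ {a | ∀ p ∈ a, n + 1 ≤ p},
      ((hL.inter hM).inter (hKl n)).inter (isLargeFamily_tail I _)⟩, ?_, ?_, ?_⟩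
    · intro a ha b hb c hc
      exact hLK _ (hML a ha.1.1.2 b hb.1.1.2) c hc.1.1.1
    · exact fun a ha => ha.1.2
    · intro h
      have := h.2 n (by simp)
      omega
  choose nxt h1 h2 h3 using next
  -- Starting from `univ` bounds all cover weights by `1`, so the submeasure is finite on
  -- singletons.
  let U : ℕ → {𝓚 // IsLargeFamily I 𝓚} := fun n =>
    Nat.rec ⟨univ, isLowerSet_univ, fun _ _ => ⟨0, fun _ _ _ => mem_univ _⟩⟩ (fun n 𝓚 => nxt n 𝓚) n
  exact ⟨fun n => (U n).1, fun n => (U n).2.lower, rfl, fun n => h1 n (U n), fun n => h3 n (U n),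
    fun A => ⟨fun hA n => (U n).2.tailIn A hA,
      fun h => hKI A fun n => (h (n + 1)).mono (h2 n (U n))⟩⟩

/-! ### From neighbourhood families to a submeasure. -/

section Metrization

variable {U : ℕ → Set (Finset ℕ)}

/-- The total weight of a list of finite sets, the `n`-th family having weight `2⁻ⁿ`. -/
noncomputable def listWeight (l : List (ℕ × Finset ℕ)) : ℝ≥0∞ :=
  (l.map fun q => (2⁻¹ : ℝ≥0∞) ^ q.1).sum

theorem listWeight_append (l l' : List (ℕ × Finset ℕ)) :
    listWeight (l ++ l') = listWeight l + listWeight l' := by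
  simp [listWeight]

theorem listWeight_cons (q : ℕ × Finset ℕ) (l : List (ℕ × Finset ℕ)) :
    listWeight (q :: l) = 2⁻¹ ^ q.1 + listWeight l := by
  simp [listWeight]

theorem exists_split_listWeight (l : List (ℕ × Finset ℕ)) {c : ℝ≥0∞} (hc : c < listWeight l) :
    ∃ l₁ q l₂, l = l₁ ++ q :: l₂ ∧ listWeight l₁ ≤ c ∧ c < listWeight l₁ + 2⁻¹ ^ q.1 := by
  induction l using List.reverseRecOn with
  | nil => simp [listWeight] at hc
  | append_singleton l q ih =>
    by_cases h : c < listWeight l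
    · obtain ⟨l₁, q', l₂, rfl, h1, h2⟩ := ih h
      exact ⟨l₁, q', l₂ ++ [q], by simp, h1, h2⟩
    · refine ⟨l, q, [], rfl, not_lt.1 h, ?_⟩
      rw [listWeight_append, listWeight_cons] at hc
      simpa [listWeight] using hc

/-- Cut the list at the entry where the running weight passes half the total. Both remaining lists
weigh less than `2⁻¹ ^ (n + 1)`, so by induction what they cover is in `U (n + 1)`; the cut entry
has index at least `n + 1`, since otherwise it alone would weigh `2⁻¹ ^ n`. The triple-union
hypothesis recombines the three pieces. -/
theorem mem_of_listWeight_lt (hlow : ∀ n, IsLowerSet (U n)) (hempty : ∀ n, ∅ ∈ U n)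
    (hU : ∀ n, ∀ a ∈ U (n + 1), ∀ b ∈ U (n + 1), ∀ c ∈ U (n + 1), a ∪ b ∪ c ∈ U n)
    (N : ℕ) (l : List (ℕ × Finset ℕ)) (hN : l.length ≤ N) (hl : ∀ q ∈ l, q.2 ∈ U q.1) (n : ℕ)
    (hn : listWeight l < 2⁻¹ ^ n) (a : Finset ℕ) (ha : ∀ p ∈ a, ∃ q ∈ l, p ∈ q.2) : a ∈ U n := by
  classical
  have hanti : Antitone U := antitone_nat_of_succ_le fun n a h => by
    simpa using hU n a h a h a h
  induction N generalizing l n a with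
  | zero =>
    obtain rfl : l = [] := List.length_eq_zero_iff.1 (Nat.le_zero.1 hN)
    have : a = ∅ := Finset.eq_empty_of_forall_notMem fun p hp => by simpa using ha p hp
    exact this ▸ hempty n
  | succ N ih =>
    have hfin : listWeight l ≠ ∞ := hn.ne_top
    rcases eq_or_ne (listWeight l) 0 with h0 | h0
    · rcases l with _ | ⟨q, l⟩
      · exact ih [] (by simp) hl n hn a ha
      · rw [listWeight_cons] at h0
        simp at h0
    obtain ⟨l₁, q, l₂, rfl, h1, h2⟩ := exists_split_listWeight l (ENNReal.half_lt_self h0 hfin)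
    have hsum : listWeight (l₁ ++ q :: l₂) = listWeight l₁ + 2⁻¹ ^ q.1 + listWeight l₂ := by
      rw [listWeight_append, listWeight_cons, add_assoc]
    have hhalf : listWeight (l₁ ++ q :: l₂) / 2 < 2⁻¹ ^ (n + 1) := by
      rw [pow_succ, ENNReal.div_eq_inv_mul, mul_comm]
      exact ENNReal.mul_lt_mul_left (by simp) (by simp) hn
    have h3 : listWeight l₂ ≤ listWeight (l₁ ++ q :: l₂) / 2 := by
      by_contra! hcon
      have := ENNReal.add_lt_add h2 hcon
      rw [ENNReal.add_halves, ← hsum] at this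
      exact this.ne rfl
    have hq : n + 1 ≤ q.1 := by
      by_contra! hcon
      have hle : (2⁻¹ : ℝ≥0∞) ^ n ≤ 2⁻¹ ^ q.1 :=
        pow_le_pow_right_of_le_one' (by simp) (Nat.lt_succ_iff.1 hcon)
      have : (2⁻¹ : ℝ≥0∞) ^ q.1 ≤ listWeight (l₁ ++ q :: l₂) := by
        rw [hsum]
        exact le_add_right le_add_self
      exact absurd hn (not_lt.2 (hle.trans this))
    simp only [List.length_append, List.length_cons] at hN
    have e1 := ih l₁ (by omega) (fun r hr => hl r (by simp [hr])) (n + 1) (h1.trans_lt hhalf)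
      (a.filter fun p => ∃ r ∈ l₁, p ∈ r.2) (by simp)
    have e2 := ih l₂ (by omega) (fun r hr => hl r (by simp [hr])) (n + 1) (h3.trans_lt hhalf)
      (a.filter fun p => ∃ r ∈ l₂, p ∈ r.2) (by simp)
    refine hlow n ?_ (hU n _ e1 _ e2 _ (hanti hq (hl q (by simp))))
    intro p hp
    obtain ⟨r, hr, hpr⟩ := ha p hp
    simp only [List.mem_append, List.mem_cons] at hr
    simp only [Finset.mem_union, Finset.mem_filter]
    rcases hr with hr | rfl | hr
    · exact Or.inl (Or.inl ⟨hp, r, hr, hpr⟩)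
    · exact Or.inr hpr
    · exact Or.inl (Or.inr ⟨hp, r, hr, hpr⟩)

/-- The least total weight of a cover of `a` by members of the families `U n`. -/
noncomputable def coverWeight (U : ℕ → Set (Finset ℕ)) (a : Finset ℕ) : ℝ≥0∞ :=
  ⨅ l : {l : List (ℕ × Finset ℕ) // (∀ q ∈ l, q.2 ∈ U q.1) ∧ ∀ p ∈ a, ∃ q ∈ l, p ∈ q.2},
    listWeight l.1

theorem coverWeight_le_of_mem {n : ℕ} {a : Finset ℕ} (ha : a ∈ U n) :
    coverWeight U a ≤ 2⁻¹ ^ n := by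
  refine (iInf_le _ ⟨[(n, a)], by simpa using ha, by simp⟩).trans ?_
  simp [listWeight]

theorem coverWeight_mono {a b : Finset ℕ} (h : a ⊆ b) : coverWeight U a ≤ coverWeight U b :=
  le_iInf fun l => iInf_le (fun l : {l : List (ℕ × Finset ℕ) //
    (∀ q ∈ l, q.2 ∈ U q.1) ∧ ∀ p ∈ a, ∃ q ∈ l, p ∈ q.2} => listWeight l.1)
    ⟨l.1, l.2.1, fun p hp => l.2.2 p (h hp)⟩

theorem coverWeight_union_le (a b : Finset ℕ) :
    coverWeight U (a ∪ b) ≤ coverWeight U a + coverWeight U b := by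
  unfold coverWeight
  rw [ENNReal.iInf_add]
  refine le_iInf fun l => ?_
  rw [ENNReal.add_iInf]
  refine le_iInf fun l' => ?_
  rw [← listWeight_append]
  refine iInf_le (fun l : {l : List (ℕ × Finset ℕ) //
    (∀ q ∈ l, q.2 ∈ U q.1) ∧ ∀ p ∈ a ∪ b, ∃ q ∈ l, p ∈ q.2} => listWeight l.1)
    ⟨l.1 ++ l'.1, fun q hq => ?_, fun p hp => ?_⟩
  · rcases List.mem_append.1 hq with hq | hq
    · exact l.2.1 q hq
    · exact l'.2.1 q hq
  · rcases Finset.mem_union.1 hp with hp | hp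
    · obtain ⟨q, hq, hpq⟩ := l.2.2 p hp
      exact ⟨q, List.mem_append.2 (Or.inl hq), hpq⟩
    · obtain ⟨q, hq, hpq⟩ := l'.2.2 p hp
      exact ⟨q, List.mem_append.2 (Or.inr hq), hpq⟩

theorem coverWeight_empty : coverWeight U ∅ = 0 := by
  refine le_antisymm ((iInf_le _ ⟨[], by simp, by simp⟩).trans ?_) zero_le
  simp [listWeight]

theorem mem_of_coverWeight_lt (hlow : ∀ n, IsLowerSet (U n)) (hempty : ∀ n, ∅ ∈ U n)
    (hU : ∀ n, ∀ a ∈ U (n + 1), ∀ b ∈ U (n + 1), ∀ c ∈ U (n + 1), a ∪ b ∪ c ∈ U n)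
    {n : ℕ} {a : Finset ℕ} (h : coverWeight U a < 2⁻¹ ^ n) : a ∈ U n := by
  obtain ⟨l, hl⟩ := iInf_lt_iff.1 h
  exact mem_of_listWeight_lt hlow hempty hU _ l.1 le_rfl l.2.1 n hl a l.2.2

/-- The lower semi-continuous submeasure of a sequence of hereditary families of finite sets. -/
noncomputable def familySubmeasure (U : ℕ → Set (Finset ℕ)) (hU0 : U 0 = univ) :
    LSCSubmeasure where
  toFun A := ⨆ a : {a : Finset ℕ // ↑a ⊆ A}, coverWeight U a.1
  map_empty := by
    refine le_antisymm (iSup_le ?_) zero_le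
    rintro ⟨a, ha⟩
    obtain rfl : a = ∅ := by simpa using ha
    exact coverWeight_empty.le
  mono A B h := iSup_le fun a => le_iSup
    (fun a : {a : Finset ℕ // ↑a ⊆ B} => coverWeight U a.1) ⟨a.1, a.2.trans h⟩
  union_le A B := by
    classical
    refine iSup_le fun a => ?_
    have : a.1 ⊆ a.1.filter (· ∈ A) ∪ a.1.filter (· ∈ B) := by
      intro p hp
      have := a.2 hp
      simpa [hp] using this
    refine (coverWeight_mono this).trans ((coverWeight_union_le _ _).trans (add_le_add ?_ ?_))
    · exact le_iSup (fun a : {a : Finset ℕ // ↑a ⊆ A} => coverWeight U a.1)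
        ⟨a.1.filter (· ∈ A), fun p hp => by simp at hp; exact hp.2⟩
    · exact le_iSup (fun a : {a : Finset ℕ // ↑a ⊆ B} => coverWeight U a.1)
        ⟨a.1.filter (· ∈ B), fun p hp => by simp at hp; exact hp.2⟩
  singleton_lt_top n := lt_of_le_of_lt (iSup_le fun a => by
    simpa using coverWeight_le_of_mem (U := U) (n := 0) (a := a.1) (hU0 ▸ mem_univ _))
      ENNReal.one_lt_top
  lsc A hA := by
    have hmono : Monotone A := monotone_nat_of_le_succ hA
    have : (⨆ a : {a : Finset ℕ // ↑a ⊆ ⋃ m, A m}, coverWeight U a.1) =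
        ⨆ m, ⨆ a : {a : Finset ℕ // ↑a ⊆ A m}, coverWeight U a.1 := by
      refine le_antisymm (iSup_le fun a => ?_) (iSup_le fun m => iSup_le fun a => ?_)
      · obtain ⟨m, hm⟩ := hmono.directed_le.exists_mem_subset_of_finset_subset_biUnion
          (s := a.1) (by simpa using a.2)
        exact le_iSup_of_le m (le_iSup
          (fun a : {a : Finset ℕ // ↑a ⊆ A m} => coverWeight U a.1) ⟨a.1, hm⟩)
      · exact le_iSup (fun a : {a : Finset ℕ // ↑a ⊆ ⋃ m, A m} => coverWeight U a.1)
          ⟨a.1, a.2.trans (subset_iUnion A m)⟩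
    rw [this]
    refine tendsto_atTop_iSup fun m n hmn => iSup_le fun a => ?_
    exact le_iSup (fun a : {a : Finset ℕ // ↑a ⊆ A n} => coverWeight U a.1)
      ⟨a.1, a.2.trans (hmono hmn)⟩

end Metrization

theorem LSCSubmeasure.mem_Exh_iff (φ : LSCSubmeasure) (A : Set ℕ) :
    A ∈ φ.Exh ↔ ∀ ε > 0, ∃ m : ℕ, φ (A \ Icc 0 m) < ε := by
  constructor
  · intro h ε hε
    exact ((tendsto_order.1 h).2 ε hε).exists
  · intro h
    refine tendsto_order.2 ⟨fun a ha => absurd ha not_lt_zero, fun ε hε => ?_⟩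
    obtain ⟨m, hm⟩ := h ε hε
    filter_upwards [eventually_ge_atTop m] with n hn
    exact (φ.mono _ _ (sdiff_subset_sdiff_right (Icc_subset_Icc_right hn))).trans_lt hm

/-- An analytic P-ideal containing the finite sets is the exhaustive ideal of a lower
semi-continuous submeasure which is positive on singletons. -/
theorem IsPIdeal.exists_submeasure {I : Order.Ideal (Set ℕ)} (hP : IsPIdeal I)
    (hA : IsAnalyticIdeal I) (hFin : ∀ A : Set ℕ, A.Finite → A ∈ I) :
    ∃ φ : LSCSubmeasure, (∀ n : ℕ, 0 < φ {n}) ∧ (I : Set (Set ℕ)) = φ.Exh := by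
  obtain ⟨U, hlow, hU0, hU, hsing, hI⟩ := hP.exists_families hA hFin
  have hempty : ∀ n, ∅ ∈ U n := fun n => by
    obtain ⟨m, hm⟩ := (hI ⊥).1 I.bot_mem n
    exact hm ∅ (by simp) (by simp)
  refine ⟨familySubmeasure U hU0, fun n => ?_, ?_⟩
  · refine lt_of_lt_of_le (b := (2⁻¹ : ℝ≥0∞) ^ (n + 1)) (ENNReal.pow_pos (by simp) _) ?_
    refine le_trans (not_lt.1 fun h => hsing n (mem_of_coverWeight_lt hlow hempty hU h)) ?_
    exact le_iSup (fun a : {a : Finset ℕ // ↑a ⊆ ({n} : Set ℕ)} => coverWeight U a.1)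
      ⟨{n}, by simp⟩
  · ext A
    rw [SetLike.mem_coe, hI, LSCSubmeasure.mem_Exh_iff]
    constructor
    · intro h ε hε
      obtain ⟨n, hn⟩ := ENNReal.exists_inv_two_pow_lt hε.ne'
      obtain ⟨m, hm⟩ := h n
      refine ⟨m, lt_of_le_of_lt (iSup_le fun a => ?_) hn⟩
      refine coverWeight_le_of_mem (hm a.1 (a.2.trans sdiff_subset) fun p hp => ?_)
      have := (a.2 hp).2
      simp at this
      exact this.le
    · intro h n
      obtain ⟨m, hm⟩ := h (2⁻¹ ^ n) (ENNReal.pow_pos (by simp) n)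
      -- The removed interval `[0, m]` includes `m`, hence the shift by one.
      refine ⟨m + 1, fun a haA ham => mem_of_coverWeight_lt hlow hempty hU (lt_of_le_of_lt ?_ hm)⟩
      refine le_iSup (fun a : {a : Finset ℕ // ↑a ⊆ A \ Icc 0 m} => coverWeight U a.1)
        ⟨a, fun p hp => ⟨haA hp, fun hpm => ?_⟩⟩
      have := ham p hp
      have := hpm.2
      omega

/-! ### The Polish group topology on `S_I`. -/

/-- The uniformity pulled back along `f ↦ (f, f⁻¹)` gives the same topology, inversion being
continuous, but has fewer Cauchy sequences. This matters for `S_I`, where a `d`-Cauchy sequence may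
converge pointwise to an injection that is not onto. -/
theorem TopologicalSpace.IsCompletelyMetrizableSpace.of_cauchySeq_inv {G : Type*} [Group G] [UniformSpace G]
    [(uniformity G).IsCountablyGenerated] [T0Space G] [ContinuousInv G]
    (H : ∀ u : ℕ → G, CauchySeq u → CauchySeq (fun n => (u n)⁻¹) → ∃ a, Tendsto u atTop (𝓝 a)) :
    TopologicalSpace.IsCompletelyMetrizableSpace G := by
  let j : G → G × G := fun f => (f, f⁻¹)
  have hj : Topology.IsInducing j := by
    refine Topology.IsInducing.of_comp (g := Prod.fst) (by fun_prop) continuous_fst ?_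
    exact Topology.IsInducing.id
  let W : UniformSpace (G × G) := inferInstance
  have hW : (@uniformity (G × G) W).IsCountablyGenerated :=
    inferInstanceAs (uniformity (G × G)).IsCountablyGenerated
  have H' : ∀ u : ℕ → G, @CauchySeq (G × G) ℕ W _ (j ∘ u) → ∃ a, Tendsto u atTop (𝓝 a) :=
    fun u hu => H u (uniformContinuous_fst.comp_cauchySeq hu)
      (uniformContinuous_snd.comp_cauchySeq hu)
  let V : UniformSpace G := (W.comap j).replaceTopology hj.eq_induced
  have hV : @uniformity G V = comap (Prod.map j j) (@uniformity (G × G) W) := by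
    rw [show V = W.comap j from UniformSpace.replaceTopology_eq _ _]
    rfl
  have hgen : (@uniformity G V).IsCountablyGenerated := by
    rw [hV]
    infer_instance
  have hju : @UniformContinuous G (G × G) V W j := by
    rw [UniformContinuous, hV]
    exact tendsto_comap
  have hc : @CompleteSpace G V :=
    @UniformSpace.complete_of_cauchySeq_tendsto G V hgen fun u hu =>
      H' u (hju.comp_cauchySeq hu)
  exact @TopologicalSpace.IsCompletelyMetrizableSpace.of_completeSpace_metrizable G V hc hgen ‹_›

theorem LSCSubmeasure.exists_pos_forall_le (φ : LSCSubmeasure) (hpos : ∀ n, 0 < φ {n})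
    {F : Set ℕ} (hF : F.Finite) : ∃ δ > 0, ∀ A, φ A < δ → Disjoint A F := by
  induction F, hF using Set.Finite.induction_on with
  | empty => exact ⟨1, one_pos, fun A _ => disjoint_empty A⟩
  | @insert p F _ _ ih =>
    obtain ⟨δ, hδ, h⟩ := ih
    refine ⟨min δ (φ {p}), lt_min hδ (hpos p), fun A hA => ?_⟩
    rw [disjoint_insert_right]
    refine ⟨fun hp => ?_, h A (hA.trans_le (min_le_left _ _))⟩
    exact absurd (hA.trans_le (min_le_right _ _))
      (not_lt.2 (φ.mono _ _ (singleton_subset_iff.2 hp)))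

/-- Only points moved by `h` can lie in `h ⁻¹' A` but not in `A`. Beyond `m` they form a `φ`-small
set, and up to `m` there are none once `A` is small enough to miss the finite set `h '' Icc 0 m`.
This is continuity of right translation; left translations are isometries. -/
theorem LSCSubmeasure.exists_preimage_lt (φ : LSCSubmeasure) (hpos : ∀ n, 0 < φ {n})
    {h : Equiv.Perm ℕ} (hh : {x | h x ≠ x} ∈ φ.Exh) {ε : ℝ≥0∞} (hε : 0 < ε) :
    ∃ δ > 0, ∀ A, φ A < δ → φ (h ⁻¹' A) < ε := by
  obtain ⟨m, hm⟩ := (φ.mem_Exh_iff _).1 hh (ε / 2) (ENNReal.half_pos hε.ne')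
  obtain ⟨δ, hδ, hA⟩ := φ.exists_pos_forall_le hpos ((finite_Icc 0 m).image h)
  refine ⟨min δ (ε / 2), lt_min hδ (ENNReal.half_pos hε.ne'), fun A hAδ => ?_⟩
  have hdisj := hA A (hAδ.trans_le (min_le_left _ _))
  have hsub : h ⁻¹' A ⊆ A ∪ {x | h x ≠ x} \ Icc 0 m := by
    intro x hx
    by_cases hxx : h x = x
    · refine Or.inl ?_
      rw [← hxx]
      exact hx
    · exact Or.inr ⟨hxx, fun hxm => disjoint_left.1 hdisj hx (mem_image_of_mem h hxm)⟩
  calc φ (h ⁻¹' A) ≤ φ A + φ ({x | h x ≠ x} \ Icc 0 m) :=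
        (φ.mono _ _ hsub).trans (φ.union_le _ _)
    _ < ε / 2 + ε / 2 := ENNReal.add_lt_add (hAδ.trans_le (min_le_right _ _)) hm
    _ = ε := ENNReal.add_halves ε

/-- Agreement is forced one point at a time by a transposition. The control on moved points keeps
the support of `f` inside that of `g`. -/
theorem Equiv.Perm.exists_eqOn_finset {α : Type*} (g : Equiv.Perm α) (F : Finset α) :
    ∃ f : Equiv.Perm α, (∀ x ∈ F, f x = g x) ∧ ∀ x, f x ≠ x → x ∈ F ∨ ∃ z ∈ F, g z = x := by
  classical
  induction F using Finset.induction_on with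
  | empty => exact ⟨1, by simp, by simp⟩
  | insert p F hp ih =>
    obtain ⟨f, hf, hfs⟩ := ih
    refine ⟨Equiv.swap (f p) (g p) * f, fun x hx => ?_, fun x hx => ?_⟩
    · rcases Finset.mem_insert.1 hx with rfl | hxF
      · simp
      · have hxp : x ≠ p := fun h => hp (h ▸ hxF)
        rw [Equiv.Perm.mul_apply, Equiv.swap_apply_of_ne_of_ne, hf x hxF]
        · simpa using hxp
        · rw [hf x hxF]
          simpa using hxp
    · by_contra! hcon
      simp only [Finset.mem_insert, not_or, forall_eq_or_imp] at hcon
      have hfx : f x = x := by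
        by_contra h
        rcases hfs x h with h | ⟨z, hz, hzx⟩
        · exact hcon.1.2 h
        · exact hcon.2.2 z hz hzx
      apply hx
      rw [Equiv.Perm.mul_apply, hfx, Equiv.swap_apply_of_ne_of_ne]
      · intro h
        exact hcon.1.1 (f.injective (hfx.trans h))
      · exact hcon.2.1.symm

section IdealPerm

variable {I : Order.Ideal (Set ℕ)} {φ : LSCSubmeasure}

theorem idealPerm_mem_nhds (f : idealPerm I) {s : Set (idealPerm I)} :
    s ∈ @nhds _ (idealPermTopology I φ) f ↔
      ∃ ε > 0, ∀ g : idealPerm I, φ {x | g.1 x ≠ f.1 x} < ε → g ∈ s :=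
  let _ := idealPermDist I φ
  EMetric.mem_nhds_iff

theorem idealPerm_continuous_eval (hpos : ∀ n, 0 < φ {n}) (p : ℕ) :
    @Continuous _ _ (idealPermTopology I φ) _ fun g : idealPerm I => g.1 p := by
  let _ := idealPermTopology I φ
  refine continuous_iff_continuousAt.2 fun f => ?_
  refine (tendsto_const_nhds (x := f.1 p)).congr' ?_
  refine (idealPerm_mem_nhds f).2 ⟨φ {p}, hpos p, fun g hg => ?_⟩
  by_contra hcon
  refine absurd hg (not_lt.2 (φ.mono _ _ (singleton_subset_iff.2 ?_)))
  exact fun h => hcon h.symm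

theorem idealPerm_t0Space (hpos : ∀ n, 0 < φ {n}) :
    @T0Space (idealPerm I) (idealPermTopology I φ) := by
  let _ := idealPermTopology I φ
  refine ⟨fun f g h => Subtype.ext (Equiv.ext fun p => ?_)⟩
  have := h.map (idealPerm_continuous_eval (I := I) hpos p)
  exact this.eq

theorem idealPerm_isTopologicalGroup (hpos : ∀ n, 0 < φ {n})
    (hI : (I : Set (Set ℕ)) = φ.Exh) :
    @IsTopologicalGroup (idealPerm I) (idealPermTopology I φ) _ := by
  let _ := idealPermTopology I φ
  have hsupp : ∀ f : idealPerm I, {x | f.1 x ≠ x} ∈ φ.Exh := fun f => by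
    rw [← hI]
    exact f.2
  have hmul : Continuous fun p : idealPerm I × idealPerm I => p.1 * p.2 := by
    refine continuous_iff_continuousAt.2 fun ⟨f, g⟩ => ?_
    refine fun s hs => mem_map.2 ?_
    obtain ⟨ε, hε, hs⟩ := (idealPerm_mem_nhds _).1 hs
    obtain ⟨δ, hδ, hδε⟩ := φ.exists_preimage_lt hpos (hsupp g) (ENNReal.half_pos hε.ne')
    have h1 : {f' : idealPerm I | φ {x | f'.1 x ≠ f.1 x} < δ} ∈ 𝓝 f :=
      (idealPerm_mem_nhds f).2 ⟨δ, hδ, fun g h => h⟩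
    have h2 : {g' : idealPerm I | φ {x | g'.1 x ≠ g.1 x} < ε / 2} ∈ 𝓝 g :=
      (idealPerm_mem_nhds g).2 ⟨ε / 2, ENNReal.half_pos hε.ne', fun g h => h⟩
    filter_upwards [prod_mem_nhds h1 h2]
    rintro ⟨f', g'⟩ ⟨hf', hg'⟩
    refine hs _ ?_
    have hsub : {x | (f' * g').1 x ≠ (f * g).1 x} ⊆
        {x | g'.1 x ≠ g.1 x} ∪ g.1 ⁻¹' {x | f'.1 x ≠ f.1 x} := by
      intro x hx
      by_cases hxx : g'.1 x = g.1 x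
      · refine Or.inr fun h => hx ?_
        change f'.1 (g'.1 x) = f.1 (g.1 x)
        rw [hxx, h]
      · exact Or.inl hxx
    calc _ ≤ _ := (φ.mono _ _ hsub).trans (φ.union_le _ _)
      _ < ε / 2 + ε / 2 := ENNReal.add_lt_add hg' (hδε _ hf')
      _ = ε := ENNReal.add_halves ε
  have hinv : Continuous fun p : idealPerm I => p⁻¹ := by
    refine continuous_iff_continuousAt.2 fun f => ?_
    refine fun s hs => mem_map.2 ?_
    obtain ⟨ε, hε, hs⟩ := (idealPerm_mem_nhds _).1 hs
    obtain ⟨δ, hδ, hδε⟩ := φ.exists_preimage_lt hpos (hsupp f⁻¹) hε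
    refine (idealPerm_mem_nhds f).2 ⟨δ, hδ, fun g hg => hs _ ?_⟩
    refine (φ.mono _ _ fun x hx => ?_).trans_lt (hδε _ hg)
    intro h
    apply hx
    change g.1 (f.1⁻¹ x) = f.1 (f.1⁻¹ x) at h
    change g.1⁻¹ x = f.1⁻¹ x
    rw [Equiv.Perm.inv_eq_iff_eq, h]
    exact (f.1.apply_symm_apply x).symm
  exact { continuous_mul := hmul, continuous_inv := hinv }

theorem idealPerm_exists_limit (hpos : ∀ n, 0 < φ {n}) (hI : (I : Set (Set ℕ)) = φ.Exh)
    {u : ℕ → idealPerm I} (hu : @CauchySeq _ _ (idealPermDist I φ).toUniformSpace _ u)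
    (hu' : @CauchySeq _ _ (idealPermDist I φ).toUniformSpace _ fun n => (u n)⁻¹) :
    ∃ f, Tendsto u atTop (@nhds _ (idealPermTopology I φ) f) := by
  let _ := idealPermDist I φ
  have stab : ∀ v : ℕ → idealPerm I, CauchySeq v → ∀ p, ∃ q, ∀ᶠ n in atTop, (v n).1 p = q := by
    intro v hv p
    obtain ⟨N, hN⟩ := EMetric.cauchySeq_iff.1 hv (φ {p}) (hpos p)
    refine ⟨(v N).1 p, eventually_atTop.2 ⟨N, fun n hn => ?_⟩⟩
    by_contra hcon
    exact absurd (hN n hn N le_rfl) (not_lt.2 (φ.mono _ _ (singleton_subset_iff.2 hcon)))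
  choose f hf using stab u hu
  choose f' hf' using stab _ hu'
  let g : Equiv.Perm ℕ :=
    { toFun := f
      invFun := f'
      left_inv := fun p => by
        obtain ⟨n, h1, h2⟩ := ((hf p).and (hf' (f p))).exists
        rw [← h2, ← h1]
        exact (u n).1.symm_apply_apply p
      right_inv := fun p => by
        obtain ⟨n, h1, h2⟩ := ((hf' p).and (hf (f' p))).exists
        rw [← h2, ← h1]
        exact (u n).1.apply_symm_apply p }
  -- The sets where `u n` differs from all `u m` with `m ≥ M` increase to `{u n ≠ g}`, so lower
  -- semi-continuity passes the Cauchy bound to the limit, weakened to `≤`.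
  have hlim : ∀ ε > 0, ∃ N, ∀ n ≥ N, φ {x | (u n).1 x ≠ g x} ≤ ε := by
    intro ε hε
    obtain ⟨N, hN⟩ := EMetric.cauchySeq_iff.1 hu ε hε
    refine ⟨N, fun n hn => ?_⟩
    have heq : {x | (u n).1 x ≠ g x} = ⋃ M, {x | ∀ m ≥ M, (u n).1 x ≠ (u m).1 x} := by
      ext x
      obtain ⟨K, hK⟩ := eventually_atTop.1 (hf x)
      simp only [mem_iUnion]
      constructor
      · exact fun h => ⟨K, fun m hm => by rw [hK m hm]; exact h⟩
      · rintro ⟨M, hM⟩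
        have := hM (max M K) (le_max_left _ _)
        rw [hK _ (le_max_right _ _)] at this
        exact this
    rw [heq]
    refine le_of_tendsto (φ.lsc _ fun M x hx m hm => hx m (by omega)) (Eventually.of_forall ?_)
    intro M
    refine (φ.mono _ _ fun x hx => ?_).trans (hN n hn (max M N) (le_max_right _ _)).le
    exact hx _ (le_max_left _ _)
  have hg : {x | g x ≠ x} ∈ I := by
    rw [← SetLike.mem_coe, hI, φ.mem_Exh_iff]
    intro ε hε
    obtain ⟨ε', hε', hlt⟩ := exists_between (ENNReal.half_pos hε.ne')
    obtain ⟨N, hN⟩ := hlim ε' hε'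
    have hsN : {x | (u N).1 x ≠ x} ∈ φ.Exh := by
      rw [← hI]
      exact (u N).2
    obtain ⟨m, hm⟩ := (φ.mem_Exh_iff _).1 hsN (ε / 2) (ENNReal.half_pos hε.ne')
    refine ⟨m, ?_⟩
    have hsub : {x | g x ≠ x} \ Icc 0 m ⊆
        {x | (u N).1 x ≠ g x} ∪ {x | (u N).1 x ≠ x} \ Icc 0 m := by
      rintro x ⟨hx, hxm⟩
      by_cases h : (u N).1 x = g x
      · exact Or.inr ⟨fun h' => hx (h.symm.trans h'), hxm⟩
      · exact Or.inl h
    calc _ ≤ _ := (φ.mono _ _ hsub).trans (φ.union_le _ _)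
      _ < ε / 2 + ε / 2 := ENNReal.add_lt_add ((hN N le_rfl).trans_lt hlt) hm
      _ = ε := ENNReal.add_halves ε
  refine ⟨⟨g, hg⟩, EMetric.tendsto_atTop.2 fun ε hε => ?_⟩
  obtain ⟨ε', hε', hlt⟩ := exists_between hε
  obtain ⟨N, hN⟩ := hlim ε' hε'
  exact ⟨N, fun n hn => (hN n hn).trans_lt hlt⟩

/-- Copying `g` on the part of its support in `[0, m]`, without moving points outside that support,
leaves a disagreement inside the `φ`-small tail of the support. -/
theorem idealPerm_dense_finite (hI : (I : Set (Set ℕ)) = φ.Exh) :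
    @Dense _ (idealPermTopology I φ) {f : idealPerm I | {x | f.1 x ≠ x}.Finite} := by
  let _ := idealPermDist I φ
  intro g
  refine EMetric.mem_closure_iff.2 fun ε hε => ?_
  have hg : {x | g.1 x ≠ x} ∈ φ.Exh := by
    rw [← hI]
    exact g.2
  obtain ⟨m, hm⟩ := (φ.mem_Exh_iff _).1 hg ε hε
  have hfin : ({x | g.1 x ≠ x} ∩ Icc 0 m).Finite := (finite_Icc 0 m).subset inter_subset_right
  obtain ⟨f, hf, hfs⟩ := g.1.exists_eqOn_finset hfin.toFinset
  have hfsub : {x | f x ≠ x} ⊆ {x | g.1 x ≠ x} := by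
    intro x hx
    rcases hfs x hx with h | ⟨z, hz, rfl⟩
    · simp only [Finite.mem_toFinset] at h
      exact h.1
    · simp only [Finite.mem_toFinset] at hz
      exact fun h => hz.1 (g.1.injective h)
  refine ⟨⟨f, I.lower hfsub g.2⟩, ?_, ?_⟩
  · refine (hfin.union (hfin.image g.1)).subset fun x hx => ?_
    rcases hfs x hx with h | ⟨z, hz, rfl⟩
    · exact Or.inl (by simpa using h)
    · exact Or.inr (mem_image_of_mem _ (by simpa using hz))
  · refine (φ.mono _ _ fun x hx => ?_).trans_lt hm
    have h1 : g.1 x ≠ x := by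
      intro h
      refine hx (h.trans ?_)
      by_contra hne
      exact hfsub (Ne.symm hne) h
    exact ⟨h1, fun hxm => hx (hf x (hfin.mem_toFinset.2 ⟨h1, hxm⟩)).symm⟩

theorem countable_finite_support (I : Order.Ideal (Set ℕ)) :
    {f : idealPerm I | {x | f.1 x ≠ x}.Finite}.Countable := by
  let j : {f : idealPerm I | {x | f.1 x ≠ x}.Finite} → (ℕ →₀ ℤ) := fun f =>
    Finsupp.ofSupportFinite (fun x => (f.1.1 x : ℤ) - x) (f.2.subset fun x hx h => hx (by simp [h]))
  have hj : Function.Injective j := by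
    intro f g h
    refine Subtype.ext (Subtype.ext (Equiv.ext fun x => ?_))
    have : ((f.1.1 x : ℤ) - x) = (g.1.1 x : ℤ) - x := DFunLike.congr_fun h x
    omega
  exact hj.countable

theorem idealPerm_polishSpace (hpos : ∀ n, 0 < φ {n}) (hI : (I : Set (Set ℕ)) = φ.Exh) :
    @PolishSpace (idealPerm I) (idealPermTopology I φ) := by
  let _ := idealPermDist I φ
  have := idealPerm_t0Space (I := I) hpos
  have := idealPerm_isTopologicalGroup hpos hI
  have : TopologicalSpace.SeparableSpace (idealPerm I) :=
    ⟨⟨_, countable_finite_support I, idealPerm_dense_finite hI⟩⟩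
  have : SecondCountableTopology (idealPerm I) := UniformSpace.secondCountable_of_separable _
  have : TopologicalSpace.IsCompletelyMetrizableSpace (idealPerm I) :=
    .of_cauchySeq_inv fun u hu hu' => idealPerm_exists_limit hpos hI hu hu'
  exact ⟨⟩

end IdealPerm

/-! ### Isomorphism of actions with finite orbits. -/

section OrbitTypes

open MulAction

variable {G X Y : Type*} [Group G] [MulAction G X] [MulAction G Y]

/-- The isomorphism type of an orbit: the set of stabilizers of its points. -/
def orbitType (ω : orbitRel.Quotient G X) : Set (Subgroup G) :=
  {H | ∃ x : X, (Quotient.mk'' x : orbitRel.Quotient G X) = ω ∧ stabilizer G x = H}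

theorem orbitType_mk (x : X) :
    orbitType (Quotient.mk'' x : orbitRel.Quotient G X) =
      range fun g : G => (stabilizer G x).map (MulAut.conj g).toMonoidHom := by
  ext H
  constructor
  · rintro ⟨x', hx', rfl⟩
    obtain ⟨g, rfl⟩ := orbitRel_apply.1 (Quotient.exact' hx')
    exact ⟨g, (stabilizer_smul_eq_stabilizer_map_conj g x).symm⟩
  · rintro ⟨g, rfl⟩
    exact ⟨g • x, Quotient.sound' (orbitRel_apply.2 (mem_orbit x g)),
      stabilizer_smul_eq_stabilizer_map_conj g x⟩

theorem orbitType_eq_of_stabilizer_eq {x : X} {y : Y} (h : stabilizer G x = stabilizer G y) :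
    orbitType (Quotient.mk'' x : orbitRel.Quotient G X) =
      orbitType (Quotient.mk'' y : orbitRel.Quotient G Y) := by
  rw [orbitType_mk, orbitType_mk, h]

/-- Infinitely many points cannot fit into finitely many finite orbits. -/
theorem infinite_setOf_orbitType_eq (hY : ∀ y : Y, (orbit G y).Finite) {x : X}
    (hxy : {y : Y | stabilizer G y = stabilizer G x}.Infinite) :
    {ω : orbitRel.Quotient G Y |
      orbitType ω = orbitType (Quotient.mk'' x : orbitRel.Quotient G X)}.Infinite := by
  intro hfin
  refine hxy ((hfin.preimage' (f := fun y : Y => (Quotient.mk'' y : orbitRel.Quotient G Y))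
    fun ω _ => ?_).subset fun y hy => orbitType_eq_of_stabilizer_eq hy)
  induction ω using Quotient.inductionOn' with
  | h z => exact (hY z).subset fun y hy => orbitRel_apply.1 (Quotient.exact' hy)

/-- Two countable actions with finite orbits, in which every stabilizer of a point of either is
the stabilizer of infinitely many points of both, are isomorphic. -/
theorem exists_equiv_smul [Countable X] [Countable Y] (hX : ∀ x : X, (orbit G x).Finite)
    (hY : ∀ y : Y, (orbit G y).Finite)
    (hXX : ∀ x : X, {x' : X | stabilizer G x' = stabilizer G x}.Infinite)
    (hXY : ∀ x : X, {y : Y | stabilizer G y = stabilizer G x}.Infinite)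
    (hYX : ∀ y : Y, {x : X | stabilizer G x = stabilizer G y}.Infinite)
    (hYY : ∀ y : Y, {y' : Y | stabilizer G y' = stabilizer G y}.Infinite) :
    ∃ e : X ≃ Y, ∀ (g : G) (x : X), e (g • x) = g • e x := by
  -- A type that occurs in either action belongs to countably infinitely many orbits of both.
  have key : ∀ t : Set (Subgroup G), Nonempty ({ω : orbitRel.Quotient G X // orbitType ω = t} ≃
      {ω : orbitRel.Quotient G Y // orbitType ω = t}) := by
    intro t
    by_cases hx : ∃ x : X, orbitType (Quotient.mk'' x : orbitRel.Quotient G X) = t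
    · obtain ⟨x, rfl⟩ := hx
      have := (infinite_setOf_orbitType_eq hX (hXX x)).to_subtype
      have := (infinite_setOf_orbitType_eq hY (hXY x)).to_subtype
      exact nonempty_equiv_of_countable (α := {ω : orbitRel.Quotient G X | _})
        (β := {ω : orbitRel.Quotient G Y | _})
    by_cases hy : ∃ y : Y, orbitType (Quotient.mk'' y : orbitRel.Quotient G Y) = t
    · obtain ⟨y, rfl⟩ := hy
      have := (infinite_setOf_orbitType_eq hX (hYX y)).to_subtype
      have := (infinite_setOf_orbitType_eq hY (hYY y)).to_subtype
      exact nonempty_equiv_of_countable (α := {ω : orbitRel.Quotient G X | _})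
        (β := {ω : orbitRel.Quotient G Y | _})
    · have : IsEmpty {ω : orbitRel.Quotient G X // orbitType ω = t} := by
        refine ⟨fun ω => ?_⟩
        obtain ⟨x, hx'⟩ := Quotient.exists_rep ω.1
        exact hx ⟨x, (congrArg orbitType hx').trans ω.2⟩
      have : IsEmpty {ω : orbitRel.Quotient G Y // orbitType ω = t} := by
        refine ⟨fun ω => ?_⟩
        obtain ⟨y, hy'⟩ := Quotient.exists_rep ω.1
        exact hy ⟨y, (congrArg orbitType hy').trans ω.2⟩
      exact ⟨Equiv.equivOfIsEmpty _ _⟩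
  let e₀ : orbitRel.Quotient G X ≃ orbitRel.Quotient G Y :=
    Equiv.ofFiberEquiv fun t => (key t).some
  have he₀ : ∀ ω, orbitType (e₀ ω) = orbitType ω := fun ω =>
    Equiv.ofFiberEquiv_map (fun t => (key t).some) ω
  have hbase : ∀ ω : orbitRel.Quotient G X, ∃ (x : X) (y : Y), Quotient.mk'' x = ω ∧
      Quotient.mk'' y = e₀ ω ∧ stabilizer G x = stabilizer G y := by
    intro ω
    obtain ⟨x, hx⟩ := Quotient.exists_rep ω
    have hmem : stabilizer G x ∈ orbitType (e₀ ω) := by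
      rw [he₀]
      exact ⟨x, hx, rfl⟩
    obtain ⟨y, hy, hxy⟩ := hmem
    exact ⟨x, y, hx, hy, hxy.symm⟩
  choose bx bY hbx hbY hst using hbase
  have hrep : ∀ x : X, ∃ g : G, g • bx (Quotient.mk'' x) = x := fun x =>
    orbitRel_apply.1 (Quotient.exact' (hbx (Quotient.mk'' x)).symm)
  choose γ hγ using hrep
  have hmk : ∀ (g : G) (x : X),
      (Quotient.mk'' (g • x) : orbitRel.Quotient G X) = Quotient.mk'' x := fun g x =>
    Quotient.sound' (orbitRel_apply.2 (mem_orbit x g))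
  have hmkY : ∀ (g : G) (y : Y),
      (Quotient.mk'' (g • y) : orbitRel.Quotient G Y) = Quotient.mk'' y := fun g y =>
    Quotient.sound' (orbitRel_apply.2 (mem_orbit y g))
  have hiff : ∀ ω (g g' : G), g • bx ω = g' • bx ω ↔ g • bY ω = g' • bY ω := by
    intro ω g g'
    have := SetLike.ext_iff.1 (hst ω) (g'⁻¹ * g)
    simpa only [mem_stabilizer_iff, mul_smul, inv_smul_eq_iff] using this
  -- By `hiff` the value does not depend on which element `γ x` carries the base point to `x`.
  let f : X → Y := fun x => γ x • bY (Quotient.mk'' x)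
  have hf : ∀ (g : G) ω, f (g • bx ω) = g • bY ω := by
    intro g ω
    have h1 : (Quotient.mk'' (g • bx ω) : orbitRel.Quotient G X) = ω := (hmk g _).trans (hbx ω)
    have h2 := hγ (g • bx ω)
    change γ (g • bx ω) • bY (Quotient.mk'' (g • bx ω)) = _
    rw [h1] at h2 ⊢
    exact (hiff ω _ _).1 h2
  have hbij : Function.Bijective f := by
    constructor
    · intro x x' h
      have h1 : (Quotient.mk'' x : orbitRel.Quotient G X) = Quotient.mk'' x' := by
        apply e₀.injective
        rw [← hbY, ← hbY, ← hmkY (γ x), ← hmkY (γ x') (bY _)]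
        exact congrArg (Quotient.mk'' : Y → orbitRel.Quotient G Y) h
      have h2 := hγ x
      have h3 : γ x • bY (Quotient.mk'' x) = γ x' • bY (Quotient.mk'' x') := h
      rw [h1] at h2 h3
      rw [← h2, ← hγ x', hγ x']
      exact ((hiff _ _ _).2 h3).trans (hγ x')
    · intro y
      have : (Quotient.mk'' y : orbitRel.Quotient G Y) =
          Quotient.mk'' (bY (e₀.symm (Quotient.mk'' y))) := by
        rw [hbY, Equiv.apply_symm_apply]
      obtain ⟨g, hg⟩ := orbitRel_apply.1 (Quotient.exact' this)
      exact ⟨g • bx (e₀.symm (Quotient.mk'' y)), (hf g _).trans hg⟩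
  refine ⟨Equiv.ofBijective f hbij, fun g x => ?_⟩
  change f (g • x) = g • f x
  conv_lhs => rw [← hγ x, ← mul_smul, hf, mul_smul]

end OrbitTypes

/-! ### Rich families as free group actions. -/

section RichFamilies

variable {ι X Y : Type*}

/-- A family of permutations is rich if it has finite orbits and every family of permutations of
a finite set embeds into it off any given finite set. -/
structure IsRichFamily (x : ι → Equiv.Perm X) : Prop where
  finite_orbit : ∀ p, ∃ F : Set X, F.Finite ∧ p ∈ F ∧ ∀ i, MapsTo (x i) F F
  copies : ∀ (k : ℕ) (σ : ι → Equiv.Perm (Fin k)) (S : Set X), S.Finite →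
    ∃ e : Fin k → X, Function.Injective e ∧ (∀ j, e j ∉ S) ∧ ∀ i j, x i (e j) = e (σ i j)

/-- The action of the free group given by a family of permutations. -/
@[reducible]
def freeGroupAction (x : ι → Equiv.Perm X) : MulAction (FreeGroup ι) X :=
  MulAction.compHom X (FreeGroup.lift x)

theorem IsRichFamily.finite_freeGroup_orbit {x : ι → Equiv.Perm X} (hx : IsRichFamily x) (p : X) :
    letI := freeGroupAction x
    (MulAction.orbit (FreeGroup ι) p).Finite := by
  let _ := freeGroupAction x
  obtain ⟨F, hF, hp, hmaps⟩ := hx.finite_orbit p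
  have := hF.to_subtype
  have key : ∀ w : FreeGroup ι, MapsTo (FreeGroup.lift x w) F F := by
    intro w
    induction w using FreeGroup.induction_on with
    | C1 => simpa using mapsTo_id F
    | of i => simpa using hmaps i
    | inv_of i h =>
      rw [map_inv]
      exact Equiv.Perm.perm_symm_mapsTo_of_mapsTo _ h
    | mul a b ha hb =>
      rw [map_mul]
      exact ha.comp hb
  refine hF.subset ?_
  rintro _ ⟨w, rfl⟩
  exact key w hp

/-- The generators permute the finite orbit of `p`. Were there only finitely many such `q`, richness
of `y` would embed a copy of this orbit avoiding them all, yet the image of `p` in the copy has the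
same stabilizer as `p`. -/
theorem IsRichFamily.infinite_stabilizer_eq {x : ι → Equiv.Perm X} {y : ι → Equiv.Perm Y}
    (hx : IsRichFamily x) (hy : IsRichFamily y) (p : X) :
    letI := freeGroupAction x
    letI := freeGroupAction y
    {q : Y | MulAction.stabilizer (FreeGroup ι) q =
      MulAction.stabilizer (FreeGroup ι) p}.Infinite := by
  let _ := freeGroupAction x
  let _ := freeGroupAction y
  intro hfin
  have := (hx.finite_freeGroup_orbit p).to_subtype
  obtain ⟨k, ⟨b⟩⟩ := Finite.exists_equiv_fin (MulAction.orbit (FreeGroup ι) p)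
  obtain ⟨e, he, heS, hee⟩ := hy.copies k
    (fun i => b.permCongr (MulAction.toPerm (FreeGroup.of i : FreeGroup ι))) _ hfin
  have hgen : ∀ i (o : MulAction.orbit (FreeGroup ι) p),
      e (b ((FreeGroup.of i : FreeGroup ι) • o)) = (FreeGroup.of i : FreeGroup ι) • e (b o) := by
    intro i o
    have h1 : (FreeGroup.of i : FreeGroup ι) • e (b o) = y i (e (b o)) := by
      change FreeGroup.lift y (FreeGroup.of i) (e (b o)) = _
      rw [FreeGroup.lift_apply_of]
    rw [h1, hee]
    simp [Equiv.permCongr_apply]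
  have hall : ∀ (w : FreeGroup ι) (o : MulAction.orbit (FreeGroup ι) p),
      e (b (w • o)) = w • e (b o) := by
    intro w
    induction w using FreeGroup.induction_on with
    | C1 => simp
    | of i => exact hgen i
    | inv_of i h =>
      intro o
      rw [eq_inv_smul_iff]
      have := hgen i ((FreeGroup.of i)⁻¹ • o)
      rw [smul_inv_smul] at this
      exact this.symm
    | mul u v hu hv =>
      intro o
      rw [mul_smul, mul_smul, hu, hv]
  let o : MulAction.orbit (FreeGroup ι) p := ⟨p, MulAction.mem_orbit_self p⟩
  refine heS (b o) (SetLike.ext fun w => ?_)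
  rw [MulAction.mem_stabilizer_iff, MulAction.mem_stabilizer_iff, ← hall, he.eq_iff,
    b.injective.eq_iff, Subtype.ext_iff]
  rfl

theorem IsRichFamily.exists_conj [Countable X] [Countable Y] {x : ι → Equiv.Perm X}
    {y : ι → Equiv.Perm Y} (hx : IsRichFamily x) (hy : IsRichFamily y) :
    ∃ e : X ≃ Y, ∀ i p, e (x i p) = y i (e p) := by
  let _ := freeGroupAction x
  let _ := freeGroupAction y
  obtain ⟨e, he⟩ := exists_equiv_smul hx.finite_freeGroup_orbit hy.finite_freeGroup_orbit
    (hx.infinite_stabilizer_eq hx) (hx.infinite_stabilizer_eq hy) (hy.infinite_stabilizer_eq hx)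
    (hy.infinite_stabilizer_eq hy)
  refine ⟨e, fun i p => ?_⟩
  have h := he (FreeGroup.of i) p
  change e (FreeGroup.lift x (FreeGroup.of i) p) = FreeGroup.lift y (FreeGroup.of i) (e p) at h
  rwa [FreeGroup.lift_apply_of, FreeGroup.lift_apply_of] at h

end RichFamilies

/-! ### Generic tuples in `S_I`. -/

section Generic

variable {I : Order.Ideal (Set ℕ)} {φ : LSCSubmeasure}

/-- A family of permutations with finite orbits into which every family of permutations of a
finite set embeds, inside `E` and beyond every bound. -/
structure IsRichIn {ι : Type*} (E : Set ℕ) (x : ι → Equiv.Perm ℕ) : Prop where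
  finite_orbit : ∀ p, ∃ F : Finset ℕ, p ∈ F ∧ ∀ i, ∀ q ∈ F, x i q ∈ F
  copies : ∀ (k : ℕ) (σ : ι → Equiv.Perm (Fin k)) (m : ℕ), ∃ e : Fin k → ℕ,
    Function.Injective e ∧ (∀ j, e j ∈ E ∧ m ≤ e j) ∧ ∀ i j, x i (e j) = e (σ i j)

theorem IsRichIn.isRichFamily_subtypePerm {ι : Type*} {E C : Set ℕ} (hEC : E ⊆ C)
    {x : ι → Equiv.Perm ℕ} (hx : IsRichIn E x) (hC : ∀ i p, x i p ∈ C ↔ p ∈ C) :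
    IsRichFamily fun i => (x i).subtypePerm (p := (· ∈ C)) (hC i) := by
  constructor
  · rintro ⟨p, hp⟩
    obtain ⟨F, hpF, hF⟩ := hx.finite_orbit p
    exact ⟨Subtype.val ⁻¹' ↑F, F.finite_toSet.preimage Subtype.val_injective.injOn, hpF,
      fun i q hq => hF i q hq⟩
  · intro k σ S hS
    obtain ⟨M, hM⟩ := (hS.image Subtype.val).bddAbove
    obtain ⟨e, he, heE, hex⟩ := hx.copies k σ (M + 1)
    refine ⟨fun j => ⟨e j, hEC (heE j).1⟩, fun j j' h => he (congrArg Subtype.val h),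
      fun j hj => ?_, fun i j => Subtype.ext (hex i j)⟩
    have := hM (mem_image_of_mem _ hj)
    have := (heE j).2
    simp only at *
    omega

/-- The conjugator needs support in `I`, so both tuples are restricted to the invariant set `C ∈ I`
containing `E` and all supports. They stay rich there, because the copies lie in `E`, and both are
trivial off `C`. -/
theorem IsRichIn.exists_conj {n : ℕ} {E : Set ℕ} (hE : E ∈ I) {x y : Fin n → idealPerm I}
    (hx : IsRichIn E fun i => (x i).1) (hy : IsRichIn E fun i => (y i).1) :
    ∃ g : idealPerm I, ∀ i, y i = g * x i * g⁻¹ := by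
  classical
  let C : Set ℕ := E ∪ ⋃ i, ({p | (x i).1 p ≠ p} ∪ {p | (y i).1 p ≠ p})
  have hsup : ∀ s : Finset (Fin n),
      (⋃ i ∈ s, ({p | (x i).1 p ≠ p} ∪ {p | (y i).1 p ≠ p})) ∈ I := by
    intro s
    induction s using Finset.induction_on with
    | empty => simpa using I.bot_mem
    | insert a s _ ih =>
      rw [Finset.set_biUnion_insert]
      exact I.sup_mem (I.sup_mem (x a).2 (y a).2) ih
  have hCI : C ∈ I := by
    refine I.sup_mem hE ?_
    simpa using hsup Finset.univ
  have hmaps : ∀ f : Equiv.Perm ℕ, {p | f p ≠ p} ⊆ C → ∀ p, f p ∈ C ↔ p ∈ C := by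
    intro f hf p
    by_cases h : f p = p
    · rw [h]
    · exact ⟨fun _ => hf h, fun _ => hf fun h' => h (f.injective h')⟩
  have hxC : ∀ i, {p | (x i).1 p ≠ p} ⊆ C := fun i =>
    (subset_union_left.trans (subset_iUnion (fun i => {p | (x i).1 p ≠ p} ∪
      {p | (y i).1 p ≠ p}) i)).trans subset_union_right
  have hyC : ∀ i, {p | (y i).1 p ≠ p} ⊆ C := fun i =>
    (subset_union_right.trans (subset_iUnion (fun i => {p | (x i).1 p ≠ p} ∪
      {p | (y i).1 p ≠ p}) i)).trans subset_union_right
  obtain ⟨e, he⟩ := (hx.isRichFamily_subtypePerm (C := C) subset_union_left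
    fun i => hmaps _ (hxC i)).exists_conj (hy.isRichFamily_subtypePerm (C := C) subset_union_left
      fun i => hmaps _ (hyC i))
  let g : Equiv.Perm ℕ := Equiv.Perm.ofSubtype (p := (· ∈ C)) e
  have hgC : ∀ p (hp : p ∈ C), g p = e ⟨p, hp⟩ := fun p hp =>
    Equiv.Perm.ofSubtype_apply_of_mem (p := (· ∈ C)) e hp
  have hgn : ∀ p, p ∉ C → g p = p := fun p hp =>
    Equiv.Perm.ofSubtype_apply_of_not_mem (p := (· ∈ C)) e hp
  refine ⟨⟨g, I.lower (fun p hp => ?_) hCI⟩, fun i => ?_⟩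
  · by_contra hpC
    exact hp (hgn p hpC)
  · rw [eq_mul_inv_iff_mul_eq]
    refine Subtype.ext (Equiv.ext fun p => ?_)
    change (y i).1 (g p) = g ((x i).1 p)
    by_cases hp : p ∈ C
    · rw [hgC p hp, hgC _ ((hmaps _ (hxC i) p).2 hp)]
      exact (congrArg Subtype.val (he i ⟨p, hp⟩)).symm
    · have h1 : (x i).1 p = p := by
        by_contra h
        exact hp (hxC i h)
      have h2 : (y i).1 p = p := by
        by_contra h
        exact hp (hyC i h)
      rw [h1, hgn p hp, h2]

theorem idealPerm_dense_finite_pi (hI : (I : Set (Set ℕ)) = φ.Exh) (n : ℕ) :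
    letI := idealPermTopology I φ
    Dense {x : Fin n → idealPerm I | ∀ i, {p | (x i).1 p ≠ p}.Finite} := by
  let _ := idealPermTopology I φ
  have := dense_pi (univ : Set (Fin n)) (s := fun _ => {f : idealPerm I | {x | f.1 x ≠ x}.Finite})
    fun i _ => idealPerm_dense_finite (φ := φ) hI
  exact Dense.mono (fun x hx i => Set.mem_univ_pi.1 hx i) this

theorem exists_embedding_mem_ge {E : Set ℕ} (hE : E.Infinite) (k m : ℕ) :
    ∃ e : Fin k ↪ ℕ, ∀ j, e j ∈ E ∧ m ≤ e j := by
  have hinf : (E \ Iio m).Infinite := hE.sdiff (finite_Iio m)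
  have := hinf.to_subtype
  let f : ℕ ↪ ↥(E \ Iio m) := Infinite.natEmbedding _
  exact ⟨⟨fun j => f j, fun j j' h => Fin.ext (f.injective (Subtype.ext h))⟩,
    fun j => ⟨(f j).2.1, not_lt.1 (f j).2.2⟩⟩

/-- Starting from finite supports, place the copy in `E` beyond all of them and so far out that the
tail of `E` is `φ`-small. Composing on the right with the copied permutations changes each
coordinate only on that tail. -/
theorem idealPerm_dense_copies (hI : (I : Set (Set ℕ)) = φ.Exh) {E : Set ℕ} (hE : E ∈ I)
    (hEinf : E.Infinite) {n : ℕ} (k : ℕ) (σ : Fin n → Equiv.Perm (Fin k)) (m : ℕ) :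
    letI := idealPermTopology I φ
    Dense {x : Fin n → idealPerm I | ∃ e : Fin k → ℕ, Function.Injective e ∧
      (∀ j, e j ∈ E ∧ m ≤ e j) ∧ ∀ i j, (x i).1 (e j) = e (σ i j)} := by
  let _ := idealPermDist I φ
  refine Dense.of_closure ((idealPerm_dense_finite_pi hI n).mono fun x hx => ?_)
  refine EMetric.mem_closure_iff.2 fun ε hε => ?_
  have hEφ : E ∈ φ.Exh := by
    rw [← hI]
    exact hE
  obtain ⟨M, hM⟩ := (φ.mem_Exh_iff _).1 hEφ ε hε
  obtain ⟨K, hK⟩ := (finite_iUnion hx).bddAbove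
  obtain ⟨e, he⟩ := exists_embedding_mem_ge hEinf k (max m (max (M + 1) (K + 1)))
  have hfix : ∀ i j, (x i).1 (e j) = e j := by
    intro i j
    by_contra h
    have h1 := hK (mem_iUnion.2 ⟨i, h⟩)
    have h2 := (le_max_right _ _).trans ((le_max_right _ _).trans (he j).2)
    omega
  have hsub : ∀ i, {p | (σ i).viaEmbedding e p ≠ p} ⊆ E \ Icc 0 M := by
    intro i p hp
    by_cases hpe : p ∈ range e
    · obtain ⟨j, rfl⟩ := hpe
      refine ⟨(he j).1, fun h => ?_⟩
      have h2 := (le_max_left _ _).trans ((le_max_right _ _).trans (he j).2)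
      have := h.2
      omega
    · exact absurd (Equiv.Perm.viaEmbedding_apply_of_notMem _ _ _ hpe) hp
  refine ⟨fun i => x i * ⟨(σ i).viaEmbedding e, I.lower ((hsub i).trans sdiff_subset) hE⟩,
    ⟨e, e.injective, fun j => ⟨(he j).1, (le_max_left _ _).trans (he j).2⟩, fun i j => ?_⟩, ?_⟩
  · change (x i).1 ((σ i).viaEmbedding e (e j)) = _
    rw [Equiv.Perm.viaEmbedding_apply, hfix]
  · refine (edist_pi_def _ _).trans_lt ((Finset.sup_lt_iff hε).2 fun i _ => (φ.mono _ _ fun p hp => ?_).trans_lt hM)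
    refine hsub i fun h => hp ?_
    change (x i).1 p = (x i).1 ((σ i).viaEmbedding e p)
    rw [h]

theorem idealPerm_isOpen_eval (hpos : ∀ n, 0 < φ {n}) {n : ℕ} (i : Fin n) (p : ℕ) (s : Set ℕ) :
    letI := idealPermTopology I φ
    IsOpen {x : Fin n → idealPerm I | (x i).1 p ∈ s} := by
  let _ := idealPermTopology I φ
  exact (isOpen_discrete s).preimage
    ((idealPerm_continuous_eval (I := I) hpos p).comp (continuous_apply i))

theorem idealPerm_residual_isRichIn (hpos : ∀ n, 0 < φ {n}) (hI : (I : Set (Set ℕ)) = φ.Exh)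
    {E : Set ℕ} (hE : E ∈ I) (hEinf : E.Infinite) (n : ℕ) :
    letI := idealPermTopology I φ
    {x : Fin n → idealPerm I | IsRichIn E fun i => (x i).1} ∈ residual (Fin n → idealPerm I) := by
  let _ := idealPermTopology I φ
  have h1 : ∀ p : ℕ, {x : Fin n → idealPerm I | ∃ F : Finset ℕ, p ∈ F ∧
      ∀ i, ∀ q ∈ F, (x i).1 q ∈ F} ∈ residual (Fin n → idealPerm I) := by
    intro p
    refine residual_of_dense_open ?_ ((idealPerm_dense_finite_pi hI n).mono fun x hx => ?_)
    · have : {x : Fin n → idealPerm I | ∃ F : Finset ℕ, p ∈ F ∧ ∀ i, ∀ q ∈ F, (x i).1 q ∈ F} =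
          ⋃ F ∈ {F : Finset ℕ | p ∈ F}, ⋂ i, ⋂ q ∈ F,
            {x : Fin n → idealPerm I | (x i).1 q ∈ (F : Set ℕ)} := by
        ext x
        simp
      rw [this]
      exact isOpen_biUnion fun F _ => isOpen_iInter_of_finite fun i =>
        isOpen_biInter_finset fun q _ => idealPerm_isOpen_eval hpos i q _
    -- For finite supports, their union together with `p` is an invariant finite set.
    · have hfin := (finite_iUnion hx).insert p
      refine ⟨hfin.toFinset, by simp, fun i q hq => ?_⟩
      by_cases h : (x i).1 q = q
      · rwa [h]
      · refine hfin.mem_toFinset.2 (Or.inr (mem_iUnion.2 ⟨i, fun h' => h ?_⟩))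
        exact (x i).1.injective h'
  have h2 : ∀ t : Σ k : ℕ, (Fin n → Equiv.Perm (Fin k)) × ℕ,
      {x : Fin n → idealPerm I | ∃ e : Fin t.1 → ℕ, Function.Injective e ∧
        (∀ j, e j ∈ E ∧ t.2.2 ≤ e j) ∧ ∀ i j, (x i).1 (e j) = e (t.2.1 i j)} ∈
          residual (Fin n → idealPerm I) := by
    rintro ⟨k, σ, m⟩
    refine residual_of_dense_open ?_ (idealPerm_dense_copies hI hE hEinf k σ m)
    have : {x : Fin n → idealPerm I | ∃ e : Fin k → ℕ, Function.Injective e ∧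
        (∀ j, e j ∈ E ∧ m ≤ e j) ∧ ∀ i j, (x i).1 (e j) = e (σ i j)} =
        ⋃ e ∈ {e : Fin k → ℕ | Function.Injective e ∧ ∀ j, e j ∈ E ∧ m ≤ e j}, ⋂ i, ⋂ j,
          {x : Fin n → idealPerm I | (x i).1 (e j) ∈ ({e (σ i j)} : Set ℕ)} := by
      ext x
      simp [and_assoc]
    rw [this]
    exact isOpen_biUnion fun e _ => isOpen_iInter_of_finite fun i =>
      isOpen_iInter_of_finite fun j => idealPerm_isOpen_eval hpos i _ _
  filter_upwards [eventually_countable_forall.2 h1, eventually_countable_forall.2 h2] with x hx1 hx2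
  exact ⟨hx1, fun k σ m => hx2 ⟨k, σ, m⟩⟩

theorem idealPerm_hasAmpleGenerics (hpos : ∀ n, 0 < φ {n}) (hI : (I : Set (Set ℕ)) = φ.Exh)
    (hinf : ∃ E ∈ I, E.Infinite) : @HasAmpleGenerics (idealPerm I) _ (idealPermTopology I φ) := by
  let _ := idealPermTopology I φ
  have hpolish : PolishSpace (idealPerm I) := idealPerm_polishSpace hpos hI
  refine ⟨idealPerm_isTopologicalGroup hpos hI, hpolish, fun n => ?_⟩
  obtain ⟨E, hE, hEinf⟩ := hinf
  have hres := idealPerm_residual_isRichIn hpos hI hE hEinf (n + 1)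
  -- Complete metrizability gives the Baire property, hence a rich tuple to represent the orbit.
  let := TopologicalSpace.upgradeIsCompletelyMetrizable (Fin (n + 1) → idealPerm I)
  obtain ⟨x, hx⟩ := (dense_of_mem_residual hres).nonempty
  exact ⟨x, mem_of_superset hres fun y hy => hx.exists_conj hE hy⟩

end Generic

theorem theorem1 (I : Order.Ideal (Set ℕ)) (hA : IsAnalyticIdeal I) (hP : IsPIdeal I)
    (hFin : {A : Set ℕ | A.Finite} ⊂ (I : Set (Set ℕ))) :
    (∃ φ : LSCSubmeasure, (∀ n : ℕ, 0 < φ {n}) ∧ (I : Set (Set ℕ)) = φ.Exh) ∧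
    ∀ φ : LSCSubmeasure, (∀ n : ℕ, 0 < φ {n}) → (I : Set (Set ℕ)) = φ.Exh →
      @HasAmpleGenerics (idealPerm I) _ (idealPermTopology I φ) := by
  refine ⟨hP.exists_submeasure hA fun A hAf => hFin.1 hAf, fun φ hpos hI => ?_⟩
  obtain ⟨E, hE, hEinf⟩ := exists_of_ssubset hFin
  exact idealPerm_hasAmpleGenerics hpos hI ⟨E, hE, hEinf⟩
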